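/- Let $(M,d_M)$ be a proper metric space (every closed ball is compact). Let $\mathbb{T}$ be the collection of measured, rooted spatial trees $\underline{\mathcal{T}}=(\mathcal{T},d_{\mathcal{T}},\mu_{\mathcal{T}},\phi_{\mathcal{T}},\rho_{\mathcal{T}})$, where $(\mathcal{T},d_{\mathcal{T}})$ is a complete and locally compact real tree, $\mu_{\mathcal{T}}$ is a locally finite Borel measure on $\mathcal{T}$, $\phi_{\mathcal{T}}:\mathcal{T}\to M$ is continuous and $\rho_{\mathcal{T}}\in\mathcal{T}$ (the root). Two elements are identified if there is a surjective isometry between them that preserves the measures, the maps into $M$ and the roots. (A real tree is a metric space in which any two points $a,b$ are joined by a unique isometric image of $[0,d(a,b)]$, and this image is also the range of every injective continuous path from $a$ to $b$.) For $r\ge 0$ let $\mathcal{T}^{(r)}$ be the closed ball of radius $r$ around $\rho_{\mathcal{T}}$, and let $\underline{\mathcal{T}}^{(r)}$ be obtained from $\underline{\mathcal{T}}$ by restricting the metric, the measure and the map to $\mathcal{T}^{(r)}$, with the same root. For compact $\underline{\mathcal{T}},\underline{\mathcal{T}}'\in\mathbb{T}$ let \[\Delta_c(\underline{\mathcal{T}},\underline{\mathcal{T}}')=\inf_{Z,\psi,\psi',\mathcal{C}}\Big\{d_P^Z\big(\mu_{\mathcal{T}}\circ\psi^{-1},\mu_{\mathcal{T}'}\circ\psi'^{-1}\big)+\sup_{(x,x')\in\mathcal{C}}\big(d_Z(\psi(x),\psi'(x'))+d_M(\phi_{\mathcal{T}}(x),\phi_{\mathcal{T}'}(x'))\big)\Big\},\]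 where the infimum is over all metric spaces $Z$, isometric embeddings $\psi:\mathcal{T}\to Z$, $\psi':\mathcal{T}'\to Z$, and correspondences $\mathcal{C}\subseteq\mathcal{T}\times\mathcal{T}'$ (sets whose projections to both factors are onto) with $(\rho_{\mathcal{T}},\rho_{\mathcal{T}'})\in\mathcal{C}$, and $d_P^Z$ is the Prohorov distance between finite Borel measures on $Z$. For $\underline{\mathcal{T}},\underline{\mathcal{T}}'\in\mathbb{T}$ let \[\Delta(\underline{\mathcal{T}},\underline{\mathcal{T}}')=\int_0^\infty e^{-r}\big(1\wedge\Delta_c(\underline{\mathcal{T}}^{(r)},\underline{\mathcal{T}}'^{(r)})\big)\,dr .\] Let $\mathcal{A}\subseteq\mathbb{T}$ be such that, for every $r>0$: (i) for every $\varepsilon>0$ there is a finite integer $N(r,\varepsilon)$ such that for every $\underline{\mathcal{T}}\in\mathcal{A}$ there is an $\varepsilon$-cover of $\mathcal{T}^{(r)}$ (a finite set of points such that every point of $\mathcal{T}^{(r)}$ is within distance $\varepsilon$ of one of them) of cardinality less than $N(r,\varepsilon)$; (ii) $\sup_{\underline{\mathcal{T}}\in\mathcal{A}}\mu_{\mathcal{T}}(\mathcal{T}^{(r)})<\infty$;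 (iii) $\{\phi_{\mathcal{T}}(\rho_{\mathcal{T}}):\underline{\mathcal{T}}\in\mathcal{A}\}$ is a bounded subset of $M$, and for every $\varepsilon>0$ there is a $\delta=\delta(r,\varepsilon)>0$ such that \[\sup_{\underline{\mathcal{T}}\in\mathcal{A}}\ \sup_{\substack{x,y\in\mathcal{T}^{(r)}:\\ d_{\mathcal{T}}(x,y)\le\delta}}d_M\big(\phi_{\mathcal{T}}(x),\phi_{\mathcal{T}}(y)\big)<\varepsilon .\] Then $\mathcal{A}$ is relatively compact in $\mathbb{T}$ with respect to the topology induced by $\Delta$, that is, its closure is compact. -/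

import Mathlib

open MeasureTheory Metric Set
open scoped ENNReal NNReal

universe u v

noncomputable section

/-- A metric space is a real tree if any two points `a`, `b` are joined by a unique isometric image
`f` of the interval `[0, dist a b]`, and every injective continuous path from `a` to `b` has the
same range as `f`. -/
def IsRealTree (X : Type u) [MetricSpace X] : Prop :=
  ∀ a b : X, ∃ f : Icc (0 : ℝ) (dist a b) → X,
    (Isometry f ∧ f ⟨0, left_mem_Icc.2 dist_nonneg⟩ = a ∧
      f ⟨dist a b, right_mem_Icc.2 dist_nonneg⟩ = b) ∧
    (∀ g : Icc (0 : ℝ) (dist a b) → X,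
      Isometry g → g ⟨0, left_mem_Icc.2 dist_nonneg⟩ = a →
        g ⟨dist a b, right_mem_Icc.2 dist_nonneg⟩ = b → g = f) ∧
    (∀ q : Icc (0 : ℝ) 1 → X,
      Continuous q → Function.Injective q → q 0 = a → q 1 = b → range q = range f)

/-- A quintuplet `(X, d, μ, φ, ρ)`: a metric space with a Borel measure, a map into `M` and a
root. The requirements on these data are imposed in `SpatialTree`. -/
structure RootedSpace (M : Type v) where
  /-- the underlying set -/
  X : Type u
  /-- the metric -/
  [metric : MetricSpace X]
  /-- the Borel sigma-algebra -/
  [meas : MeasurableSpace X]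
  [borel : BorelSpace X]
  /-- the measure -/
  μ : Measure X
  /-- the map into the image space -/
  φ : X → M
  /-- the root -/
  ρ : X

attribute [instance] RootedSpace.metric RootedSpace.meas RootedSpace.borel

/-- A measured, rooted spatial tree with image space `M`. -/
structure SpatialTree (M : Type v) [MetricSpace M] extends RootedSpace.{u, v} M where
  realTree : IsRealTree X
  complete : CompleteSpace X
  locallyCompact : LocallyCompactSpace X
  locallyFinite : IsLocallyFiniteMeasure μ
  continuous_φ : Continuous φ

namespace RootedSpace

variable {M : Type v}

/-- The closed ball of radius `r` around the root. -/
def rootBall (T : RootedSpace.{u, v} M) (r : ℝ) : Set T.X := closedBall T.ρ r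

/-- The restriction of all the data to the closed ball of radius `r` around the root. -/
def restrict (T : RootedSpace.{u, v} M) (r : ℝ≥0) : RootedSpace.{u, v} M where
  X := T.rootBall r
  μ := T.μ.comap Subtype.val
  φ := fun x => T.φ x
  ρ := ⟨T.ρ, mem_closedBall_self r.coe_nonneg⟩

/-- A correspondence between two sets. -/
def IsCorrespondence {X Y : Type u} (C : Set (X × Y)) : Prop :=
  (∀ x, ∃ y, (x, y) ∈ C) ∧ (∀ y, ∃ x, (x, y) ∈ C)

/-- The Prohorov distance between two Borel measures on a metric space, transported there from
measured spaces along the maps `ψ` and `ψ'`. -/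
def prohorovDist {X Y Z : Type u} [MeasurableSpace X] [MeasurableSpace Y] [MetricSpace Z]
    (μ : Measure X) (ν : Measure Y) (ψ : X → Z) (ψ' : Y → Z) : ℝ≥0∞ :=
  letI : MeasurableSpace Z := _root_.borel Z
  levyProkhorovEDist (μ.map ψ) (ν.map ψ')

/-- The distance `Δ_c`: the infimum, over all metric spaces `Z`, isometric embeddings `ψ`, `ψ'` into
`Z` and correspondences `C` containing the pair of roots, of the Prohorov distance of the image
measures plus the supremum over `C` of the distances in `Z` and in `M`. It is the distance of
the compact spatial trees, and is written here without using the tree property. -/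
def deltaC [MetricSpace M] (T T' : RootedSpace.{u, v} M) : ℝ≥0∞ :=
  ⨅ (Z : Type u) (_ : MetricSpace Z) (ψ : T.X → Z) (ψ' : T'.X → Z) (C : Set (T.X × T'.X))
    (_ : Isometry ψ) (_ : Isometry ψ') (_ : IsCorrespondence C) (_ : (T.ρ, T'.ρ) ∈ C),
    prohorovDist T.μ T'.μ ψ ψ' +
      ⨆ p ∈ C, (edist (ψ p.1) (ψ' p.2) + edist (T.φ p.1) (T'.φ p.2))

end RootedSpace

namespace SpatialTree

variable {M : Type v} [MetricSpace M]

/-- The distance `Δ(T, T') = ∫₀^∞ e^{-r} (1 ∧ Δ_c(T^{(r)}, T'^{(r)})) dr`, where `T^{(r)}` is the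
restriction of `T` to the closed ball of radius `r` around the root. It is at most `1`. -/
def delta (T T' : SpatialTree.{u, v} M) : ℝ≥0∞ :=
  ∫⁻ r in Ioi (0 : ℝ), ENNReal.ofReal (Real.exp (-r)) *
    min 1 ((T.restrict r.toNNReal).deltaC (T'.restrict r.toNNReal))

/-- The topology induced by `Δ`: a set is open if it contains a `Δ`-ball around each of its
points. -/
instance : TopologicalSpace (SpatialTree.{u, v} M) where
  IsOpen U := ∀ T ∈ U, ∃ ε : ℝ≥0∞, 0 < ε ∧ ∀ T', delta T T' < ε → T' ∈ U
  isOpen_univ := fun _ _ => ⟨1, one_pos, fun _ _ => mem_univ _⟩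
  isOpen_inter := fun U V hU hV T hT => by
    obtain ⟨a, ha, hUa⟩ := hU T hT.1
    obtain ⟨b, hb, hVb⟩ := hV T hT.2
    exact ⟨min a b, lt_min ha hb, fun T' h =>
      ⟨hUa T' (h.trans_le (min_le_left _ _)), hVb T' (h.trans_le (min_le_right _ _))⟩⟩
  isOpen_sUnion := fun S hS T ⟨U, hU, hT⟩ => by
    obtain ⟨a, ha, hUa⟩ := hS U hU T hT
    exact ⟨a, ha, fun T' h => ⟨U, hU, hUa T' h⟩⟩

/-- Two spatial trees are equivalent if there is a (surjective) isometry between them that preserves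
the measures, the maps into `M` and the roots. -/
def Equivalent (T T' : SpatialTree.{u, v} M) : Prop :=
  ∃ π : T.X ≃ᵢ T'.X, T.μ.map π = T'.μ ∧ (∀ x, T.φ x = T'.φ (π x)) ∧ π T.ρ = T'.ρ

/-- Equivalence of spatial trees is an equivalence relation. -/
instance setoid : Setoid (SpatialTree.{u, v} M) where
  r := Equivalent
  iseqv := {
    refl := fun T => ⟨IsometryEquiv.refl T.X, Measure.map_id, fun _ => rfl, rfl⟩
    symm := by
      rintro T T' ⟨π, hμ, hφ, hρ⟩
      refine ⟨π.symm, ?_, fun x => by simp [hφ], by simp [← hρ]⟩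
      rw [← hμ, Measure.map_map π.symm.continuous.measurable π.continuous.measurable]
      have h : ⇑π.symm ∘ ⇑π = id := funext π.symm_apply_apply
      rw [h, Measure.map_id]
    trans := by
      rintro T T' T'' ⟨π, hμ, hφ, hρ⟩ ⟨π', hμ', hφ', hρ'⟩
      refine ⟨π.trans π', ?_, fun x => by simp [hφ, hφ'], by simp [hρ, hρ']⟩
      rw [← hμ', ← hμ, Measure.map_map π'.continuous.measurable π.continuous.measurable]
      rfl }

end SpatialTree

/-- The space of equivalence classes of spatial trees. It carries the quotient topology, which is the
topology of the distance that `Δ` induces on the equivalence classes. -/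
abbrev SpatialTreeSpace (M : Type v) [MetricSpace M] : Type (max (u + 1) v) :=
  Quotient (SpatialTree.setoid.{u, v} (M := M))

end

/-! The hypotheses are turned into countably many bounds, one family for each integer scale `m`, on
separated sets, masses and the modulus of continuity in the ball of radius `m + 1` (`TreeBounds`,
`SpatialTree.Obeys`). The trees that obey fixed bounds form a set that contains `A`, is saturated
under equivalence, and is closed and compact. Closedness (`isClosed_obeys`) is proved directly, so
neither the triangle inequality for `Δ` nor a Hausdorff property of the quotient is needed.

For compactness, every ultrafilter on that set must converge (`exists_tendsto_delta`). All the trees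
have nets of uniformly bounded size. Along the ultrafilter the mutual distances of net points
converge, and the completion of the resulting countable pseudometric space is the limit space; it is
proper because the nets stay finite at each scale. It is a real tree because real trees are exactly
the metric spaces with the four-point condition and with points at all intermediate distances
(`IsRealTree.fourPoint`, `FourPoint.isRealTree`). These two properties pass to the limit, one as a
closed inequality and the other by compactness. Equicontinuity and properness of `M` give the limit
map. The measures, moved onto net points of the limit space, have a vague limit by the Riesz
theorem.

Gluing the limit tree to a tree of the family along their nets shows that the two are close on large
balls (`Close`). Truncating at radius `r` then costs at most the mass of a thin annulus of the limit
tree around the sphere of radius `r`. This tends to zero unless `r` is one of the countably many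
jumps of the mass of balls, and dominated convergence gives convergence in `Δ`. -/

open MeasureTheory Metric Set
open scoped ENNReal NNReal

noncomputable section

/-! ### Real trees and the four-point condition -/

section RealTree

variable {X : Type u} [MetricSpace X]

/-- The four-point condition, that is, `0`-hyperbolicity in the sense of Gromov. -/
def FourPoint (X : Type u) [PseudoMetricSpace X] : Prop :=
  ∀ x y z w : X, dist x y + dist z w ≤ max (dist x z + dist y w) (dist x w + dist y z)

/-- Between any two points there are points at all intermediate distances. -/
def HasBetween (X : Type u) [PseudoMetricSpace X] : Prop :=
  ∀ a b : X, ∀ t ∈ Icc (0 : ℝ) (dist a b), ∃ z, dist a z = t ∧ dist z b = dist a b - t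

theorem IsRealTree.exists_geodesic (h : IsRealTree X) (a b : X) :
    ∃ γ : ℝ → X, Continuous γ ∧ γ 0 = a ∧ γ (dist a b) = b ∧
      ∀ s ∈ Icc 0 (dist a b), ∀ t ∈ Icc 0 (dist a b), dist (γ s) (γ t) = |s - t| := by
  obtain ⟨f, ⟨hf, h0, h1⟩, -, -⟩ := h a b
  refine ⟨IccExtend dist_nonneg f, hf.continuous.Icc_extend', ?_, ?_, ?_⟩
  · rw [IccExtend_of_mem _ _ (left_mem_Icc.2 dist_nonneg), h0]
  · rw [IccExtend_of_mem _ _ (right_mem_Icc.2 dist_nonneg), h1]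
  · intro s hs t ht
    rw [IccExtend_of_mem _ _ hs, IccExtend_of_mem _ _ ht, hf.dist_eq]
    rfl

theorem IsRealTree.hasBetween (h : IsRealTree X) : HasBetween X := by
  intro a b t ht
  obtain ⟨γ, -, h0, h1, hγ⟩ := h.exists_geodesic a b
  refine ⟨γ t, ?_, ?_⟩
  · have := hγ 0 (left_mem_Icc.2 dist_nonneg) t ht
    rw [h0] at this
    rw [this, zero_sub, abs_neg, abs_of_nonneg ht.1]
  · have := hγ t ht _ (right_mem_Icc.2 dist_nonneg)
    rw [h1] at this
    rw [this, abs_sub_comm, abs_of_nonneg (sub_nonneg.2 ht.2)]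

/-- The geodesics from `x` to `y` and to `z` agree at a last time `t`, and `c` is the common point.
They do not meet later: a meeting point is reached by both at the same time, its distance to `x`.
Hence the way from `y` back to `c` and on to `z` is an injective path, and the path clause of
`IsRealTree` puts `c` on the geodesic from `y` to `z`. -/
theorem IsRealTree.exists_median (h : IsRealTree X) (x y z : X) :
    ∃ c, dist x c + dist c y = dist x y ∧ dist x c + dist c z = dist x z ∧
      dist y c + dist c z = dist y z := by
  obtain ⟨f, fc, f0, f1, hf⟩ := h.exists_geodesic x y
  obtain ⟨g, gc, g0, g1, hg⟩ := h.exists_geodesic x z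
  set D₁ := dist x y with hD₁
  set D₂ := dist x z with hD₂
  have hD₁' : 0 ≤ D₁ := dist_nonneg
  have hD₂' : 0 ≤ D₂ := dist_nonneg
  have hcpt : IsCompact (Icc 0 (min D₁ D₂) ∩ {t | f t = g t}) :=
    isCompact_Icc.inter_right (isClosed_eq fc gc)
  obtain ⟨t, ⟨⟨ht0, htm⟩, hfg⟩, htmax⟩ := hcpt.exists_isGreatest
    ⟨0, ⟨le_rfl, le_min hD₁' hD₂'⟩, by simp [f0, g0]⟩
  have ht₁ : t ≤ D₁ := htm.trans (min_le_left _ _)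
  have ht₂ : t ≤ D₂ := htm.trans (min_le_right _ _)
  have hfg : f t = g t := hfg
  have hxf : ∀ s ∈ Icc 0 D₁, dist x (f s) = s := fun s hs => by
    have := hf 0 ⟨le_rfl, hD₁'⟩ s hs
    rwa [f0, zero_sub, abs_neg, abs_of_nonneg hs.1] at this
  have hxg : ∀ s ∈ Icc 0 D₂, dist x (g s) = s := fun s hs => by
    have := hg 0 ⟨le_rfl, hD₂'⟩ s hs
    rwa [g0, zero_sub, abs_neg, abs_of_nonneg hs.1] at this
  have hfy : dist (f t) y = D₁ - t := by
    have := hf t ⟨ht0, ht₁⟩ D₁ ⟨hD₁', le_rfl⟩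
    rwa [f1, abs_sub_comm, abs_of_nonneg (by linarith)] at this
  have hgz : dist (f t) z = D₂ - t := by
    have := hg t ⟨ht0, ht₂⟩ D₂ ⟨hD₂', le_rfl⟩
    rwa [g1, abs_sub_comm, abs_of_nonneg (by linarith), ← hfg] at this
  have hxt := hxf t ⟨ht0, ht₁⟩
  refine ⟨f t, by linarith, by linarith, ?_⟩
  set L := (D₁ - t) + (D₂ - t) with hL
  rcases (show 0 ≤ L by linarith).eq_or_lt with hL0 | hL0
  · have h1 : f t = y := by rw [← dist_eq_zero]; linarith
    rw [h1, dist_self, zero_add]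
  set q : Icc (0 : ℝ) 1 → X := fun v =>
    if (v : ℝ) * L ≤ D₁ - t then f (D₁ - v * L) else g (t + (v * L - (D₁ - t))) with hq
  have qc : Continuous q := by
    refine Continuous.if_le (by fun_prop) (by fun_prop) (by fun_prop) (by fun_prop) ?_
    intro v hv
    rw [hv]
    simpa using hfg
  have key : ∀ v w : Icc (0 : ℝ) 1, (v : ℝ) * L ≤ D₁ - t → D₁ - t < w * L → q v ≠ q w := by
    intro v w hv hw heq
    have hv0 : 0 ≤ (v : ℝ) * L := mul_nonneg v.2.1 hL0.le
    have hwL : (w : ℝ) * L ≤ L := mul_le_of_le_one_left hL0.le w.2.2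
    simp only [hq, if_pos hv, if_neg hw.not_ge] at heq
    have e1 := hxf (D₁ - v * L) ⟨by linarith, by linarith⟩
    have e2 := hxg (t + (w * L - (D₁ - t))) ⟨by linarith, by linarith⟩
    rw [heq, e2] at e1
    have hle : t + (w * L - (D₁ - t)) ≤ t := by
      refine htmax ⟨⟨by linarith, le_min (by linarith) (by linarith)⟩, ?_⟩
      show f _ = g _
      rw [← heq, e1]
    linarith
  have qi : Function.Injective q := by
    intro v w heq
    have hv0 : 0 ≤ (v : ℝ) * L := mul_nonneg v.2.1 hL0.le
    have hw0 : 0 ≤ (w : ℝ) * L := mul_nonneg w.2.1 hL0.le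
    have hvL : (v : ℝ) * L ≤ L := mul_le_of_le_one_left hL0.le v.2.2
    have hwL : (w : ℝ) * L ≤ L := mul_le_of_le_one_left hL0.le w.2.2
    have fin : (v : ℝ) * L = w * L → v = w := fun e => Subtype.ext (mul_right_cancel₀ hL0.ne' e)
    by_cases hv : (v : ℝ) * L ≤ D₁ - t <;> by_cases hw : (w : ℝ) * L ≤ D₁ - t
    · simp only [hq, if_pos hv, if_pos hw] at heq
      have e1 := hxf (D₁ - v * L) ⟨by linarith, by linarith⟩
      have e2 := hxf (D₁ - w * L) ⟨by linarith, by linarith⟩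
      rw [heq, e2] at e1
      exact fin (by linarith)
    · exact absurd heq (key v w hv (not_le.1 hw))
    · exact absurd heq.symm (key w v hw (not_le.1 hv))
    · simp only [hq, if_neg hv, if_neg hw] at heq
      have e1 := hxg (t + (v * L - (D₁ - t))) ⟨by linarith, by linarith⟩
      have e2 := hxg (t + (w * L - (D₁ - t))) ⟨by linarith, by linarith⟩
      rw [heq, e2] at e1
      exact fin (by linarith)
  obtain ⟨k, ⟨hk, k0, k1⟩, -, hrange⟩ := h y z
  have q0 : q 0 = y := by
    simp only [hq, Icc.coe_zero, zero_mul, sub_zero]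
    rw [if_pos (by linarith), f1]
  have q1 : q 1 = z := by
    rcases ht₂.eq_or_lt with he | hlt
    · simp only [hq, Icc.coe_one, one_mul]
      rw [if_pos (by linarith), show D₁ - L = D₂ by linarith, ← he, hfg, he, g1]
    · simp only [hq, Icc.coe_one, one_mul]
      rw [if_neg (by linarith), show t + (L - (D₁ - t)) = D₂ by linarith, g1]
  have hr := hrange q qc qi q0 q1
  have hmem : f t ∈ range q := by
    refine ⟨⟨(D₁ - t) / L, div_nonneg (by linarith) hL0.le,
      (div_le_one hL0).2 (by linarith)⟩, ?_⟩
    simp only [hq, div_mul_cancel₀ _ hL0.ne', le_refl, if_true]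
    congr 1
    ring
  rw [hr] at hmem
  obtain ⟨s, hs⟩ := hmem
  have e1 := hk.dist_eq ⟨0, left_mem_Icc.2 dist_nonneg⟩ s
  have e2 := hk.dist_eq s ⟨dist y z, right_mem_Icc.2 dist_nonneg⟩
  rw [k0, hs, Subtype.dist_eq, Real.dist_eq, abs_of_nonpos (by simpa using s.2.1)] at e1
  rw [k1, hs, Subtype.dist_eq, Real.dist_eq, abs_of_nonpos (by linarith [s.2.2])] at e2
  rw [e1, e2]
  simp

/-- Points of a segment are determined by their distance to an end point. -/
theorem IsRealTree.eq_of_mem_segment (h : IsRealTree X) {w x p p' : X}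
    (hp : dist w p + dist p x = dist w x) (hp' : dist w p' + dist p' x = dist w x)
    (heq : dist w p = dist w p') : p = p' := by
  obtain ⟨f, -, huniq, -⟩ := h w x
  have key : ∀ p, dist w p + dist p x = dist w x → ∀ ht : dist w p ∈ Icc 0 (dist w x),
      f ⟨dist w p, ht⟩ = p := by
    intro p hp ht
    obtain ⟨a, -, a0, a1, ha⟩ := h.exists_geodesic w p
    obtain ⟨b, -, b0, b1, hb⟩ := h.exists_geodesic p x
    -- The geodesics through `p` concatenate to a geodesic from `w` to `x`, which must be `f` by
    -- uniqueness.
    set g : ℝ → X := fun s => if s ≤ dist w p then a s else b (s - dist w p) with hg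
    have g0 : g 0 = w := by simp only [hg, dist_nonneg, if_true, a0]
    have gp : g (dist w p) = p := by simp only [hg, le_refl, if_true, a1]
    have g1 : g (dist w x) = x := by
      rcases (show dist w p ≤ dist w x from ht.2).eq_or_lt with he | hlt
      · rw [← he, gp, ← dist_eq_zero]; linarith
      · simp only [hg, if_neg hlt.not_ge]
        rw [show dist w x - dist w p = dist p x by linarith, b1]
    have mixed : ∀ s t, 0 ≤ s → s ≤ dist w p → dist w p < t → t ≤ dist w x →
        dist (g s) (g t) ≤ t - s := by
      intro s t h0 hs ht' h1
      simp only [hg, if_pos hs, if_neg ht'.not_ge]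
      have e1 := ha s ⟨h0, hs⟩ _ ⟨dist_nonneg, le_rfl⟩
      have e2 := hb 0 ⟨le_rfl, dist_nonneg⟩ (t - dist w p) ⟨by linarith, by linarith⟩
      rw [a1, abs_of_nonpos (by linarith)] at e1
      rw [b0, abs_of_nonpos (by linarith)] at e2
      linarith [dist_triangle (a s) p (b (t - dist w p))]
    have glip : ∀ s t, 0 ≤ s → s ≤ t → t ≤ dist w x → dist (g s) (g t) ≤ t - s := by
      intro s t h0 hst h1
      by_cases hs : s ≤ dist w p <;> by_cases ht' : t ≤ dist w p
      · simp only [hg, if_pos hs, if_pos ht']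
        rw [ha s ⟨h0, hs⟩ t ⟨by linarith, ht'⟩, abs_of_nonpos (by linarith)]
        linarith
      · exact mixed s t h0 hs (not_le.1 ht') h1
      · exact absurd (hst.trans ht') hs
      · simp only [hg, if_neg hs, if_neg ht']
        rw [not_le] at hs ht'
        rw [hb _ ⟨by linarith, by linarith⟩ _ ⟨by linarith, by linarith⟩,
          abs_of_nonpos (by linarith)]
        linarith
    have giso : ∀ s t, 0 ≤ s → s ≤ t → t ≤ dist w x → dist (g s) (g t) = t - s := by
      intro s t h0 hst h1
      refine le_antisymm (glip s t h0 hst h1) ?_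
      have e1 := glip 0 s le_rfl h0 (by linarith)
      have e2 := glip t _ (by linarith) h1 le_rfl
      rw [g0] at e1
      rw [g1] at e2
      linarith [dist_triangle4 w (g s) (g t) x]
    have := huniq (fun s => g s) ?_ g0 g1
    · rw [← this]; exact gp
    · refine Isometry.of_dist_eq fun s t => ?_
      rw [Subtype.dist_eq, Real.dist_eq]
      rcases le_total (s : ℝ) t with hst | hst
      · rw [giso s t s.2.1 hst t.2.2, abs_of_nonpos (by linarith)]; ring
      · rw [dist_comm, giso t s t.2.1 hst s.2.2, abs_of_nonneg (by linarith)]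
  rw [← key p hp ⟨dist_nonneg, by linarith [dist_nonneg (x := p) (y := x)]⟩,
    ← key p' hp' ⟨dist_nonneg, by linarith [dist_nonneg (x := p') (y := x)]⟩]
  congr 1
  exact Subtype.ext heq

/-- In terms of Gromov products the claim is `(x|y) ≥ min (x|z) (y|z)`. Up to the distance `(x|z)`
from `w`, the segments to `x` and `z` coincide, by the median. At the distance given by the minimum,
the segments to `x`, `y` and `z` therefore share a point, and a path from `x` to `y` through it
bounds `dist x y`. -/
theorem IsRealTree.fourPoint (h : IsRealTree X) : FourPoint X := by
  have hbranch : ∀ w x z : X, ∀ t, 0 ≤ t → 2 * t ≤ dist w x + dist w z - dist x z →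
      ∃ p, dist w p = t ∧ dist w p + dist p x = dist w x ∧ dist w p + dist p z = dist w z := by
    intro w x z t h0 ht
    obtain ⟨c, h1, h2, h3⟩ := h.exists_median w x z
    obtain ⟨p, hp, hp'⟩ := h.hasBetween w c t ⟨h0, by linarith [dist_comm x c]⟩
    refine ⟨p, hp, le_antisymm ?_ (dist_triangle _ _ _), le_antisymm ?_ (dist_triangle _ _ _)⟩
    · linarith [dist_triangle p c x]
    · linarith [dist_triangle p c z]
  intro x y z w
  by_contra! hlt
  obtain ⟨ha, hb⟩ := max_lt_iff.1 hlt
  -- Gromov products are taken at `w`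
  set t := min ((dist w x + dist w z - dist x z) / 2) ((dist w y + dist w z - dist y z) / 2)
  have ht0 : 0 ≤ t := le_min (by linarith [dist_triangle_left x z w])
    (by linarith [dist_triangle_left y z w])
  have ht1 : t ≤ (dist w x + dist w z - dist x z) / 2 := min_le_left _ _
  have ht2 : t ≤ (dist w y + dist w z - dist y z) / 2 := min_le_right _ _
  obtain ⟨p, p1, p2, p3⟩ := hbranch w x z t ht0 (by linarith)
  obtain ⟨p', q1, q2, q3⟩ := hbranch w y z t ht0 (by linarith)
  obtain rfl := h.eq_of_mem_segment p3 q3 (by rw [p1, q1])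
  have hxy := dist_triangle x p y
  rw [dist_comm x p] at hxy
  have : (dist w x + dist w y - dist x y) / 2 ≥ t := by linarith
  rcases le_total ((dist w x + dist w z - dist x z) / 2)
      ((dist w y + dist w z - dist y z) / 2) with hm | hm
  · have : t = _ := min_eq_left hm
    linarith [dist_comm w y, dist_comm w z, dist_comm w x]
  · have : t = _ := min_eq_right hm
    linarith [dist_comm w y, dist_comm w z, dist_comm w x]

/-- Removing `z` separates `a` from `b`: the points whose Gromov product with `a` at `z` is positive
form an open set, and by the four-point condition so do the other points different from `z`. -/
theorem FourPoint.segment_subset_of_isPreconnected (h4 : FourPoint X) {s : Set X}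
    (hs : IsPreconnected s) {a b z : X} (ha : a ∈ s) (hb : b ∈ s)
    (hz : dist a z + dist z b = dist a b) : z ∈ s := by
  by_contra hzs
  have hz' : ∀ x ∈ s, 0 < dist x z := fun x hx => dist_pos.2 fun e => hzs (e ▸ hx)
  set U : Set X := {x | dist x a < dist x z + dist a z}
  have hU : IsOpen U := isOpen_lt (by fun_prop) (by fun_prop)
  have hV : IsOpen {x | ¬ dist x a < dist x z + dist a z ∧ x ≠ z} := by
    rw [Metric.isOpen_iff]
    rintro x ⟨hx, hxz⟩
    refine ⟨dist x z / 2, half_pos (dist_pos.2 hxz), fun y hy => ⟨fun hya => hx ?_, ?_⟩⟩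
    · rw [mem_ball] at hy
      have := h4 x a y z
      have t1 := dist_triangle_left x z y
      rcases le_max_iff.1 this with h | h
      · linarith [dist_comm x y, dist_comm y z, dist_pos.2 hxz]
      · linarith [dist_comm x y, dist_comm y a]
    · rintro rfl
      rw [mem_ball, dist_comm] at hy
      linarith [dist_pos.2 hxz]
  have hsub : s ⊆ U ∪ {x | ¬ dist x a < dist x z + dist a z ∧ x ≠ z} := by
    intro x hx
    by_cases hxa : dist x a < dist x z + dist a z
    · exact Or.inl hxa
    · exact Or.inr ⟨hxa, fun e => hzs (e ▸ hx)⟩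
  have hbV : ¬ dist b a < dist b z + dist a z := by
    rw [dist_comm b a, dist_comm b z]
    linarith
  obtain ⟨x, hx, hxU, hxV⟩ := hs U _ hU hV hsub ⟨a, ha, by simpa [U] using hz' a ha⟩
    ⟨b, hb, hbV, fun e => hzs (e ▸ hb)⟩
  exact hxV.1 hxU

theorem FourPoint.eq_of_mem_segment (h4 : FourPoint X) {a b p q : X}
    (hp : dist a p + dist p b = dist a b) (hq : dist a q + dist q b = dist a b)
    (h : dist a p = dist a q) : p = q := by
  have := h4 p q a b
  rw [← dist_le_zero]
  rcases le_max_iff.1 this with h' | h' <;> linarith [dist_comm a p, dist_comm a q]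

/-- The idea lies in the clause on injective paths. If a point of the path were off the segment, the
branch point of the tripod that it spans with `a` and `b` would be visited both before and after it,
since connected sets contain segments; this contradicts injectivity. -/
theorem FourPoint.isRealTree (h4 : FourPoint X) (hb : HasBetween X) : IsRealTree X := by
  intro a b
  have : Nonempty X := ⟨a⟩
  choose! γ hγ1 hγ2 using hb a b
  have hiso : ∀ s ∈ Icc 0 (dist a b), ∀ t ∈ Icc 0 (dist a b), s ≤ t →
      dist (γ s) (γ t) = t - s := by
    intro s hs t ht hst
    refine le_antisymm ?_ ?_
    · have := h4 (γ s) (γ t) a b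
      rcases le_max_iff.1 this with h | h <;>
      linarith [hγ1 s hs, hγ1 t ht, hγ2 s hs, hγ2 t ht, dist_comm a (γ s), dist_comm a (γ t)]
    · linarith [dist_triangle a (γ s) (γ t), hγ1 s hs, hγ1 t ht]
  have hseg : ∀ z, dist a z + dist z b = dist a b → γ (dist a z) = z := by
    intro z hz
    have hm : dist a z ∈ Icc 0 (dist a b) := ⟨dist_nonneg,
      by linarith [dist_nonneg (x := z) (y := b)]⟩
    exact h4.eq_of_mem_segment (by rw [hγ1 _ hm, hγ2 _ hm]; ring) hz (hγ1 _ hm)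
  have h0m : (0 : ℝ) ∈ Icc 0 (dist a b) := left_mem_Icc.2 dist_nonneg
  have h1m : dist a b ∈ Icc 0 (dist a b) := right_mem_Icc.2 dist_nonneg
  refine ⟨fun s => γ s, ⟨?_, ?_, ?_⟩, ?_, ?_⟩
  · refine Isometry.of_dist_eq fun s t => ?_
    rw [Subtype.dist_eq, Real.dist_eq]
    rcases le_total (s : ℝ) t with hst | hst
    · rw [hiso s s.2 t t.2 hst, abs_of_nonpos (by linarith)]; ring
    · rw [dist_comm, hiso t t.2 s s.2 hst, abs_of_nonneg (by linarith)]
  · exact (dist_eq_zero.1 (hγ1 0 h0m)).symm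
  · exact dist_eq_zero.1 (by rw [hγ2 _ h1m, sub_self])
  · intro g hg g0 g1
    funext s
    have e1 : dist a (g s) = s := by
      have e := hg.dist_eq ⟨0, left_mem_Icc.2 dist_nonneg⟩ s
      rw [g0, Subtype.dist_eq, Real.dist_eq, abs_of_nonpos (by simpa using s.2.1)] at e
      simpa using e
    have e2 : dist (g s) b = dist a b - s := by
      have e := hg.dist_eq s ⟨dist a b, right_mem_Icc.2 dist_nonneg⟩
      rw [g1, Subtype.dist_eq, Real.dist_eq, abs_of_nonpos (by linarith [s.2.2])] at e
      linarith
    have := hseg (g s) (by rw [e1, e2]; ring)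
    rw [e1] at this
    exact this.symm
  · intro q qc qi q0 q1
    apply Subset.antisymm
    · rintro _ ⟨s, rfl⟩
      have hsub : ∀ S : Set (Icc (0 : ℝ) 1), OrdConnected S → IsPreconnected (q '' S) := by
        intro S hS
        exact hS.isPreconnected.image _ qc.continuousOn
      have key : dist a (q s) + dist (q s) b = dist a b := by
        refine le_antisymm ?_ (dist_triangle _ _ _)
        by_contra! hlt
        -- the branch point of the tripod spanned by `q s`, `a`, `b`
        set p := q s
        set t := (dist a p + dist p b - dist a b) / 2 with ht
        have ht0 : 0 < t := by linarith
        obtain ⟨c, c1, c2⟩ := hb p a t ⟨ht0.le, by linarith [dist_triangle p a b, dist_comm p a]⟩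
        obtain ⟨c', d1, d2⟩ := hb p b t ⟨ht0.le,
          by linarith [dist_triangle a b p, dist_comm b p]⟩
        have e1 : dist a c' ≤ dist a p - t := by
          rcases le_max_iff.1 (h4 a c' p b) with h | h <;>
          linarith [dist_comm p c', dist_comm b p]
        have e2 : dist c c' ≤ 0 := by
          rcases le_max_iff.1 (h4 c c' p a) with h | h <;>
          linarith [dist_comm c p, dist_comm c' p, dist_comm c' a, dist_comm a p]
        have ecc : c = c' := dist_le_zero.1 e2
        subst ecc
        have m1 : c ∈ q '' Iic s := by
          refine h4.segment_subset_of_isPreconnected (hsub _ ordConnected_Iic)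
            (a := p) (b := a) ⟨s, self_mem_Iic, rfl⟩ ⟨0, s.2.1, q0⟩ (by linarith)
        have m2 : c ∈ q '' Ici s := by
          refine h4.segment_subset_of_isPreconnected (hsub _ ordConnected_Ici)
            (a := p) (b := b) ⟨s, self_mem_Ici, rfl⟩ ⟨1, s.2.2, q1⟩ (by linarith)
        obtain ⟨u₁, hu₁, e⟩ := m1
        obtain ⟨u₂, hu₂, e'⟩ := m2
        obtain rfl := qi (e.trans e'.symm)
        obtain rfl : u₁ = s := le_antisymm hu₁ hu₂
        rw [← e, dist_self] at c1
        linarith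
      exact ⟨⟨dist a (q s), dist_nonneg, by linarith [dist_nonneg (x := q s) (y := b)]⟩,
        hseg _ key⟩
    · rintro _ ⟨s, rfl⟩
      refine h4.segment_subset_of_isPreconnected (isPreconnected_range qc)
        (a := a) (b := b) ⟨0, q0⟩ ⟨1, q1⟩ ?_
      rw [hγ1 s s.2, hγ2 s s.2]; ring

end RealTree

/-! ### Vague limits of measures along ultrafilters -/

section Vague

open Filter Topology CompactlySupported

theorem Ultrafilter.exists_tendsto_of_eventually_mem {ι Y : Type*} [TopologicalSpace Y]
    (G : Ultrafilter ι) {f : ι → Y} {s : Set Y} (hs : IsCompact s) (hf : ∀ᶠ k in G, f k ∈ s) :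
    ∃ y ∈ s, Tendsto f G (𝓝 y) :=
  hs.ultrafilter_le_nhds (G.map f) (le_principal_iff.2 hf)

theorem norm_integral_le_of_hasCompactSupport {X : Type*} [MetricSpace X] [MeasurableSpace X]
    (g : C_c(X, ℝ)) (x₀ : X) :
    ∃ R B : ℝ, 0 ≤ B ∧ ∀ ν : Measure X, ν (closedBall x₀ R) < ∞ →
      ‖∫ x, g x ∂ν‖ ≤ B * (ν (closedBall x₀ R)).toReal := by
  obtain ⟨R, hR⟩ := g.hasCompactSupport.isCompact.isBounded.subset_closedBall x₀
  obtain ⟨B, hB⟩ := g.hasCompactSupport.exists_bound_of_continuous g.continuous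
  refine ⟨R, B, (norm_nonneg _).trans (hB x₀), fun ν hν => ?_⟩
  rw [← setIntegral_eq_integral_of_forall_compl_eq_zero (s := closedBall x₀ R)]
  · exact norm_setIntegral_le_of_norm_le_const hν fun x _ => hB x
  · intro x hx
    by_contra h0
    exact hx (hR (subset_tsupport _ h0))

variable {X : Type*} [MetricSpace X] [ProperSpace X] [MeasurableSpace X] [BorelSpace X]
  {ι : Type*}

/-- Measures that are eventually uniformly bounded on balls have a vague limit. -/
theorem exists_vague_limit (G : Ultrafilter ι) (ν : ι → Measure X) [∀ k, IsFiniteMeasure (ν k)]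
    (x₀ : X) (hb : ∀ R : ℝ, ∃ C : ℝ≥0, ∀ᶠ k in G, ν k (closedBall x₀ R) ≤ C) :
    ∃ μ : Measure X, IsLocallyFiniteMeasure μ ∧
      ∀ g : C_c(X, ℝ), Tendsto (fun k => ∫ x, g x ∂(ν k)) G (𝓝 (∫ x, g x ∂μ)) := by
  have hinteg : ∀ (g : C_c(X, ℝ)) k, Integrable g (ν k) := fun g k =>
    g.continuous.integrable_of_hasCompactSupport g.hasCompactSupport
  have hlim : ∀ g : C_c(X, ℝ), ∃ a, Tendsto (fun k => ∫ x, g x ∂(ν k)) G (𝓝 a) := by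
    intro g
    obtain ⟨R, B, hB, hg⟩ := norm_integral_le_of_hasCompactSupport g x₀
    obtain ⟨C, hC⟩ := hb R
    have hmem : ∀ᶠ k in G, ∫ x, g x ∂(ν k) ∈ closedBall (0 : ℝ) (B * C) := by
      filter_upwards [hC] with k hk
      rw [mem_closedBall_zero_iff]
      refine (hg (ν k) (measure_lt_top _ _)).trans (mul_le_mul_of_nonneg_left ?_ hB)
      exact ENNReal.toReal_le_coe_of_le_coe hk
    obtain ⟨a, -, ha⟩ := G.exists_tendsto_of_eventually_mem (isCompact_closedBall _ _) hmem
    exact ⟨a, ha⟩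
  choose L hL using hlim
  let Λ : C_c(X, ℝ) →ₗ[ℝ] ℝ :=
    { toFun := L
      map_add' := fun g h => by
        refine tendsto_nhds_unique (hL (g + h)) (((hL g).add (hL h)).congr fun k => ?_)
        rw [← integral_add (hinteg g k) (hinteg h k)]
        rfl
      map_smul' := fun c g => by
        refine tendsto_nhds_unique (hL (c • g)) (((hL g).const_smul c).congr fun k => ?_)
        rw [← integral_smul]
        rfl }
  let Λ' : C_c(X, ℝ) →ₚ[ℝ] ℝ := PositiveLinearMap.mk₀ Λ fun g hg =>
    ge_of_tendsto' (hL g) fun k => integral_nonneg fun x => hg x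
  refine ⟨RealRMK.rieszMeasure Λ', inferInstance, fun g => ?_⟩
  rw [RealRMK.integral_rieszMeasure]
  exact hL g

theorem measure_le_ofReal_integral_le {U V : Set X} (hU : IsClosed U) (hV : IsOpen V)
    (g : C_c(X, ℝ)) (g1 : ∀ x ∈ U, g x = 1) (g0 : ∀ x ∉ V, g x = 0)
    (gm : ∀ x, g x ∈ Icc (0 : ℝ) 1) (ν : Measure X) [IsLocallyFiniteMeasure ν] :
    ν U ≤ ENNReal.ofReal (∫ x, g x ∂ν) ∧ ENNReal.ofReal (∫ x, g x ∂ν) ≤ ν V := by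
  have hinteg : Integrable g ν := g.continuous.integrable_of_hasCompactSupport g.hasCompactSupport
  rw [ofReal_integral_eq_lintegral_ofReal hinteg (Eventually.of_forall fun x => (gm x).1)]
  constructor
  · rw [← lintegral_indicator_one hU.measurableSet]
    refine lintegral_mono fun x => ?_
    by_cases hx : x ∈ U
    · simp [hx, g1]
    · simp [hx]
  · rw [← lintegral_indicator_one hV.measurableSet]
    refine lintegral_mono fun x => ?_
    by_cases hx : x ∈ V
    · simpa [hx] using (gm x).2
    · simp [hx, g0]

/-- Vague convergence gives convergence in the sense of Prohorov, locally. -/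
theorem eventually_measure_le_measure_thickening {G : Filter ι} {ν : ι → Measure X}
    [∀ k, IsFiniteMeasure (ν k)] {μ : Measure X} [IsLocallyFiniteMeasure μ]
    (h : ∀ g : C_c(X, ℝ), Tendsto (fun k => ∫ x, g x ∂(ν k)) G (𝓝 (∫ x, g x ∂μ)))
    (x₀ : X) (R : ℝ) {η : ℝ} (hη : 0 < η) :
    ∀ᶠ k in G, ∀ A ⊆ closedBall x₀ R, ν k A ≤ μ (thickening η A) + ENNReal.ofReal η ∧
      μ A ≤ ν k (thickening η A) + ENNReal.ofReal η := by
  classical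
  have hη4 : 0 < η / 4 := by positivity
  -- Uniformity in `A`: each `A` is replaced by the union of the balls of a finite cover that meet
  -- it, so only finitely many test functions occur. Three errors of size `η / 4` stay below `η`.
  obtain ⟨t, ht, htfin, hcov⟩ := finite_cover_balls_of_compact (isCompact_closedBall x₀ R) hη4
  lift t to Finset X using htfin
  let U : Finset X → Set X := fun s => ⋃ y ∈ s, closedBall y (η / 4)
  have hU : ∀ s, IsClosed (U s) := fun s =>
    s.finite_toSet.isClosed_biUnion fun _ _ => isClosed_closedBall
  have hbump : ∀ s ∈ t.powerset, ∃ g : C_c(X, ℝ), (∀ x ∈ U s, g x = 1) ∧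
      (∀ x ∉ thickening (η / 4) (U s), g x = 0) ∧ ∀ x, g x ∈ Icc (0 : ℝ) 1 := by
    intro s hs
    rw [Finset.mem_powerset] at hs
    have hz : ∀ x ∉ thickening (η / 4) (U s), thickenedIndicator hη4 (U s) x = 0 := fun x hx =>
      thickenedIndicator_zero hη4 _ hx
    refine ⟨⟨⟨fun x => (thickenedIndicator hη4 (U s) x : ℝ), by fun_prop⟩, ?_⟩, ?_, ?_, ?_⟩
    · refine HasCompactSupport.intro (isCompact_closedBall x₀ (R + η)) fun x hx => ?_
      have : thickenedIndicator hη4 (U s) x = 0 := by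
        refine hz x fun hx' => hx ?_
        obtain ⟨w, hw, hxw⟩ := mem_thickening_iff.1 hx'
        simp only [U, mem_iUnion] at hw
        obtain ⟨y, hy, hyw⟩ := hw
        have := ht (hs hy)
        rw [mem_closedBall] at *
        linarith [dist_triangle4 x w y x₀]
      simp [this]
    · intro x hx
      show (thickenedIndicator hη4 (U s) x : ℝ) = 1
      rw [thickenedIndicator_one hη4 (U s) hx, NNReal.coe_one]
    · intro x hx
      show (thickenedIndicator hη4 (U s) x : ℝ) = 0
      rw [hz x hx, NNReal.coe_zero]
    · intro x
      exact ⟨NNReal.coe_nonneg _, by exact_mod_cast thickenedIndicator_le_one hη4 (U s) x⟩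
  choose! g g1 g0 gm using hbump
  have hev : ∀ᶠ k in G, ∀ s ∈ t.powerset, dist (∫ x, g s x ∂(ν k)) (∫ x, g s x ∂μ) < η :=
    (Finset.eventually_all _).2 fun s _ => (h (g s)).eventually (ball_mem_nhds _ hη)
  filter_upwards [hev] with k hk A hA
  set s := t.filter fun y => (ball y (η / 4) ∩ A).Nonempty with hs
  have hst : s ∈ t.powerset := Finset.mem_powerset.2 (Finset.filter_subset _ _)
  have hAU : A ⊆ U s := by
    intro x hx
    have := hcov (hA hx)
    simp only [mem_iUnion] at this
    obtain ⟨y, hy, hxy⟩ := this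
    simp only [U, mem_iUnion]
    exact ⟨y, Finset.mem_filter.2 ⟨hy, x, hxy, hx⟩, ball_subset_closedBall hxy⟩
  have hUA : thickening (η / 4) (U s) ⊆ thickening η A := by
    intro x hx
    obtain ⟨w, hw, hxw⟩ := mem_thickening_iff.1 hx
    simp only [U, mem_iUnion] at hw
    obtain ⟨y, hy, hyw⟩ := hw
    obtain ⟨a, hay, ha⟩ := (Finset.mem_filter.1 hy).2
    refine mem_thickening_iff.2 ⟨a, ha, ?_⟩
    rw [mem_ball] at hay
    rw [mem_closedBall] at hyw
    linarith [dist_triangle4 x w y a, dist_comm y a]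
  obtain ⟨a1, a2⟩ := measure_le_ofReal_integral_le (hU s) isOpen_thickening (g s) (g1 s hst)
    (g0 s hst) (gm s hst) (ν k)
  obtain ⟨b1, b2⟩ := measure_le_ofReal_integral_le (hU s) isOpen_thickening (g s) (g1 s hst)
    (g0 s hst) (gm s hst) μ
  have hd := hk s hst
  rw [Real.dist_eq, abs_lt] at hd
  have ofReal_le : ∀ {a b : ℝ}, a ≤ b + η → ENNReal.ofReal a ≤ ENNReal.ofReal b + ENNReal.ofReal η :=
    fun h => (ENNReal.ofReal_le_ofReal h).trans ENNReal.ofReal_add_le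
  constructor
  · calc ν k A ≤ _ := (measure_mono hAU).trans a1
      _ ≤ ENNReal.ofReal (∫ x, g s x ∂μ) + ENNReal.ofReal η := ofReal_le (by linarith)
      _ ≤ _ := by gcongr; exact b2.trans (measure_mono hUA)
  · calc μ A ≤ _ := (measure_mono hAU).trans b1
      _ ≤ ENNReal.ofReal (∫ x, g s x ∂(ν k)) + ENNReal.ofReal η := ofReal_le (by linarith)
      _ ≤ _ := by gcongr; exact a2.trans (measure_mono hUA)

end Vague

/-! ### Upper bounds for the distances -/

namespace RootedSpace

variable {M : Type v}

theorem map_restrict_apply (T : RootedSpace.{u, v} M) (r : ℝ≥0) {Z : Type u} [MetricSpace Z]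
    [MeasurableSpace Z] [BorelSpace Z] {ψ : (T.restrict r).X → Z} (hψ : Continuous ψ)
    {B : Set Z} (hB : MeasurableSet B) :
    (T.restrict r).μ.map ψ B = T.μ {x | ∃ h : x ∈ closedBall T.ρ r, ψ ⟨x, h⟩ ∈ B} := by
  rw [Measure.map_apply hψ.measurable hB]
  have hm : MeasurableSet (closedBall T.ρ (r : ℝ)) := measurableSet_closedBall
  refine (comap_subtype_coe_apply (s := closedBall T.ρ (r : ℝ)) hm T.μ _).trans ?_
  congr 1
  ext x
  constructor
  · rintro ⟨y, hy, rfl⟩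
    exact ⟨y.2, hy⟩
  · rintro ⟨h, hx⟩
    exact ⟨⟨x, h⟩, hx, rfl⟩

theorem deltaC_le [MetricSpace M] {T T' : RootedSpace.{u, v} M} {Z : Type u} [MetricSpace Z]
    {ψ : T.X → Z} {ψ' : T'.X → Z} {C : Set (T.X × T'.X)} (hψ : Isometry ψ) (hψ' : Isometry ψ')
    (hC : IsCorrespondence C) (hρ : (T.ρ, T'.ρ) ∈ C) :
    T.deltaC T' ≤ prohorovDist T.μ T'.μ ψ ψ' +
      ⨆ p ∈ C, (edist (ψ p.1) (ψ' p.2) + edist (T.φ p.1) (T'.φ p.2)) := by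
  unfold deltaC
  refine iInf_le_of_le Z (iInf_le_of_le inferInstance (iInf_le_of_le ψ (iInf_le_of_le ψ'
    (iInf_le_of_le C ?_))))
  exact iInf_le_of_le hψ (iInf_le_of_le hψ' (iInf_le_of_le hC (iInf_le_of_le hρ le_rfl)))

end RootedSpace

namespace SpatialTree

open RootedSpace

variable {M : Type v} [MetricSpace M]

/-- `T` and `T'` can be embedded in a metric space in such a way that, in the closed balls of radius
`R` around their roots, they are `η`-close as measured, rooted, spatial metric spaces. The maps into
`M` are compared at points whose distance is small with respect to another constant `θ ≤ η`. -/
def Close (T T' : SpatialTree.{u, v} M) (η R : ℝ) : Prop :=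
  ∃ (θ : ℝ) (Z : Type u) (_ : MetricSpace Z) (ψ : T.X → Z) (ψ' : T'.X → Z),
    0 < θ ∧ θ ≤ η ∧ Isometry ψ ∧ Isometry ψ' ∧ dist (ψ T.ρ) (ψ' T'.ρ) ≤ θ ∧
    (∀ x ∈ closedBall T.ρ R, ∃ y, dist (ψ x) (ψ' y) ≤ θ) ∧
    (∀ y ∈ closedBall T'.ρ R, ∃ x, dist (ψ x) (ψ' y) ≤ θ) ∧
    (∀ x ∈ closedBall T.ρ R, ∀ y ∈ closedBall T'.ρ R, dist (ψ x) (ψ' y) ≤ 3 * θ →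
      dist (T.φ x) (T'.φ y) ≤ η) ∧
    (∀ A ⊆ closedBall T.ρ R,
      T.μ A ≤ T'.μ {y | ∃ x ∈ A, dist (ψ x) (ψ' y) < θ} + ENNReal.ofReal θ) ∧
    (∀ B ⊆ closedBall T'.ρ R,
      T'.μ B ≤ T.μ {x | ∃ y ∈ B, dist (ψ x) (ψ' y) < θ} + ENNReal.ofReal θ)

theorem exists_mem_closedBall_dist_le (T : SpatialTree.{u, v} M) {r s : ℝ} (hr : 0 ≤ r)
    (hs : 0 ≤ s) {y : T.X} (hy : dist y T.ρ ≤ r + s) : ∃ z ∈ closedBall T.ρ r, dist y z ≤ s := by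
  rcases le_or_gt (dist y T.ρ) r with h | h
  · exact ⟨y, h, by simpa⟩
  · obtain ⟨z, h1, h2⟩ := T.realTree.hasBetween y T.ρ (dist y T.ρ - r) ⟨by linarith, by linarith⟩
    exact ⟨z, by rw [mem_closedBall]; linarith, by linarith⟩

/-- A `θ`-partner of a point of the ball of radius `r` may lie outside the other ball, but by at
most `2 * θ`; sliding it along the geodesic to the root gives a partner inside, at distance at most
`3 * θ`. The terms `θ`, `3 * θ` and `η` add up to at most `5 * η`. -/
theorem Close.deltaC_restrict_le {T T' : SpatialTree.{u, v} M} {η R : ℝ} (h : Close T T' η R)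
    {r : ℝ} (hr : 0 < r) (hrR : r ≤ R) :
    (T.restrict r.toNNReal).deltaC (T'.restrict r.toNNReal) ≤
      ENNReal.ofReal (5 * η) +
        T.μ (closedBall T.ρ (r + 2 * η) \ closedBall T.ρ (r - 2 * η)) := by
  obtain ⟨θ, Z, _, ψ, ψ', hθ, hθη, hψ, hψ', hρ, h1, h2, hφ, hμ, hμ'⟩ := h
  have hrr : ((r.toNNReal : ℝ≥0) : ℝ) = r := Real.coe_toNNReal r hr.le
  set a := T.μ (closedBall T.ρ (r + 2 * θ) \ closedBall T.ρ (r - 2 * θ)) with ha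
  have mem : ∀ x : (T.restrict r.toNNReal).X, x.1 ∈ closedBall T.ρ r := fun x =>
    (mem_closedBall.1 x.2).trans hrr.le
  have mem' : ∀ x : (T'.restrict r.toNNReal).X, x.1 ∈ closedBall T'.ρ r := fun x =>
    (mem_closedBall.1 x.2).trans hrr.le
  let C : Set ((T.restrict r.toNNReal).X × (T'.restrict r.toNNReal).X) :=
    {p | dist (ψ p.1.1) (ψ' p.2.1) ≤ 3 * θ}
  have iψ : Isometry fun x : (T.restrict r.toNNReal).X => ψ x.1 := hψ.comp isometry_subtype_coe
  have iψ' : Isometry fun x : (T'.restrict r.toNNReal).X => ψ' x.1 :=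
    hψ'.comp isometry_subtype_coe
  have hC : IsCorrespondence C := by
    constructor
    · intro x
      obtain ⟨y, hy⟩ := h1 x.1 (closedBall_subset_closedBall hrR (mem x))
      have hyρ : dist y T'.ρ ≤ r + 2 * θ := by
        rw [← hψ'.dist_eq]
        have := mem x
        rw [mem_closedBall, ← hψ.dist_eq] at this
        linarith [dist_triangle4 (ψ' y) (ψ x.1) (ψ T.ρ) (ψ' T'.ρ), dist_comm (ψ' y) (ψ x.1)]
      obtain ⟨z, hz, hyz⟩ := T'.exists_mem_closedBall_dist_le hr.le (by linarith) hyρ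
      refine ⟨⟨z, ?_⟩, ?_⟩
      · show z ∈ closedBall T'.ρ _
        rwa [hrr]
      · show dist (ψ x.1) (ψ' z) ≤ 3 * θ
        rw [← hψ'.dist_eq] at hyz
        linarith [dist_triangle (ψ x.1) (ψ' y) (ψ' z)]
    · intro y
      obtain ⟨x, hx⟩ := h2 y.1 (closedBall_subset_closedBall hrR (mem' y))
      have hxρ : dist x T.ρ ≤ r + 2 * θ := by
        rw [← hψ.dist_eq]
        have := mem' y
        rw [mem_closedBall, ← hψ'.dist_eq] at this
        linarith [dist_triangle4 (ψ x) (ψ' y.1) (ψ' T'.ρ) (ψ T.ρ),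
          dist_comm (ψ' T'.ρ) (ψ T.ρ)]
      obtain ⟨z, hz, hxz⟩ := T.exists_mem_closedBall_dist_le hr.le (by linarith) hxρ
      refine ⟨⟨z, ?_⟩, ?_⟩
      · show z ∈ closedBall T.ρ _
        rwa [hrr]
      · show dist (ψ z) (ψ' y.1) ≤ 3 * θ
        rw [← hψ.dist_eq] at hxz
        linarith [dist_triangle_left (ψ z) (ψ' y.1) (ψ x)]
  have hCρ : ((T.restrict r.toNNReal).ρ, (T'.restrict r.toNNReal).ρ) ∈ C :=
    show dist (ψ T.ρ) (ψ' T'.ρ) ≤ 3 * θ by linarith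
  have hsup : ⨆ p ∈ C, (edist (ψ p.1.1) (ψ' p.2.1) +
      edist ((T.restrict r.toNNReal).φ p.1) ((T'.restrict r.toNNReal).φ p.2)) ≤
      ENNReal.ofReal (3 * θ + η) := by
    refine iSup₂_le fun p hp => ?_
    have hp : dist (ψ p.1.1) (ψ' p.2.1) ≤ 3 * θ := hp
    have := hφ p.1.1 (closedBall_subset_closedBall hrR (mem p.1)) p.2.1
      (closedBall_subset_closedBall hrR (mem' p.2)) hp
    rw [edist_dist, edist_dist, ← ENNReal.ofReal_add dist_nonneg dist_nonneg]
    refine ENNReal.ofReal_le_ofReal ?_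
    change dist (ψ p.1.1) (ψ' p.2.1) + dist (T.φ p.1.1) (T'.φ p.2.1) ≤ 3 * θ + η
    linarith
  have hP : prohorovDist (T.restrict r.toNNReal).μ (T'.restrict r.toNNReal).μ
      (fun x : (T.restrict r.toNNReal).X => ψ x.1)
      (fun x : (T'.restrict r.toNNReal).X => ψ' x.1) ≤ ENNReal.ofReal θ + a := by
    let _ : MeasurableSpace Z := _root_.borel Z
    have : BorelSpace Z := ⟨rfl⟩
    refine levyProkhorovEDist_le_of_forall _ _ _ fun ε B hε hεt hB => ?_
    have hθε : θ < ε.toReal := by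
      rw [← ENNReal.ofReal_lt_iff_lt_toReal hθ.le hεt.ne]
      exact le_self_add.trans_lt hε
    have hBt : MeasurableSet (thickening ε.toReal B) := isOpen_thickening.measurableSet
    rw [map_restrict_apply T.toRootedSpace _ iψ.continuous hB,
      map_restrict_apply T'.toRootedSpace _ iψ'.continuous hB,
      map_restrict_apply T.toRootedSpace _ iψ.continuous hBt,
      map_restrict_apply T'.toRootedSpace _ iψ'.continuous hBt]
    simp only [exists_prop, hrr]
    constructor
    -- Both inequalities discard mass in `T` only, so that the error depends on `T` and not on `T'`.
    -- Here the set is first shrunk to radius `r - 2 * θ`, which keeps its partners in the ball of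
    -- radius `r`.
    · calc T.μ {x | x ∈ closedBall T.ρ r ∧ ψ x ∈ B}
          ≤ T.μ ({x | x ∈ closedBall T.ρ (r - 2 * θ) ∧ ψ x ∈ B} ∪
              (closedBall T.ρ (r + 2 * θ) \ closedBall T.ρ (r - 2 * θ))) := by
            refine measure_mono fun x hx => ?_
            by_cases h : x ∈ closedBall T.ρ (r - 2 * θ)
            · exact Or.inl ⟨h, hx.2⟩
            · exact Or.inr ⟨closedBall_subset_closedBall (by linarith) hx.1, h⟩
        _ ≤ T.μ {x | x ∈ closedBall T.ρ (r - 2 * θ) ∧ ψ x ∈ B} + a := measure_union_le _ _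
        _ ≤ T'.μ {y | ∃ x ∈ {x | x ∈ closedBall T.ρ (r - 2 * θ) ∧ ψ x ∈ B},
              dist (ψ x) (ψ' y) < θ} + ENNReal.ofReal θ + a := by
            gcongr
            exact hμ _ fun x hx => closedBall_subset_closedBall (by linarith) hx.1
        _ ≤ T'.μ {y | y ∈ closedBall T'.ρ r ∧ ψ' y ∈ thickening ε.toReal B} +
              ENNReal.ofReal θ + a := by
            gcongr with y
            rintro ⟨x, ⟨hx, hxB⟩, hxy⟩
            refine ⟨?_, mem_thickening_iff.2 ⟨ψ x, hxB, ?_⟩⟩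
            · rw [mem_closedBall, ← hψ.dist_eq] at hx
              rw [mem_closedBall, ← hψ'.dist_eq]
              linarith [dist_triangle4 (ψ' y) (ψ x) (ψ T.ρ) (ψ' T'.ρ),
                dist_comm (ψ' y) (ψ x)]
            · rw [dist_comm]; linarith
        _ ≤ _ := by rw [add_assoc]; gcongr
    · calc T'.μ {y | y ∈ closedBall T'.ρ r ∧ ψ' y ∈ B}
          ≤ T.μ {x | ∃ y ∈ {y | y ∈ closedBall T'.ρ r ∧ ψ' y ∈ B}, dist (ψ x) (ψ' y) < θ} +
              ENNReal.ofReal θ := hμ' _ fun y hy => closedBall_subset_closedBall hrR hy.1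
        _ ≤ T.μ ({x | x ∈ closedBall T.ρ r ∧ ψ x ∈ thickening ε.toReal B} ∪
              (closedBall T.ρ (r + 2 * θ) \ closedBall T.ρ (r - 2 * θ))) +
              ENNReal.ofReal θ := by
            refine add_le_add_left (measure_mono ?_) _
            rintro x ⟨y, ⟨hy, hyB⟩, hxy⟩
            have hx : dist x T.ρ ≤ r + 2 * θ := by
              rw [mem_closedBall, ← hψ'.dist_eq] at hy
              rw [← hψ.dist_eq]
              linarith [dist_triangle4 (ψ x) (ψ' y) (ψ' T'.ρ) (ψ T.ρ),
                dist_comm (ψ' T'.ρ) (ψ T.ρ)]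
            by_cases h : x ∈ closedBall T.ρ r
            · exact Or.inl ⟨h, mem_thickening_iff.2 ⟨ψ' y, hyB, by linarith⟩⟩
            · exact Or.inr ⟨hx, fun h' => h (closedBall_subset_closedBall (by linarith) h')⟩
        _ ≤ T.μ {x | x ∈ closedBall T.ρ r ∧ ψ x ∈ thickening ε.toReal B} + a +
              ENNReal.ofReal θ := by
            gcongr
            exact measure_union_le _ _
        _ ≤ _ := by rw [add_assoc, add_comm a]; gcongr
  calc (T.restrict r.toNNReal).deltaC (T'.restrict r.toNNReal)
      ≤ (ENNReal.ofReal θ + a) + ENNReal.ofReal (3 * θ + η) :=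
        (deltaC_le iψ iψ' hC hCρ).trans (add_le_add hP hsup)
    _ = ENNReal.ofReal (4 * θ + η) + a := by
        rw [add_right_comm, ← ENNReal.ofReal_add hθ.le (by linarith)]
        ring_nf
    _ ≤ _ := by
        refine add_le_add (ENNReal.ofReal_le_ofReal (by linarith)) (measure_mono ?_)
        exact sdiff_subset_sdiff (closedBall_subset_closedBall (by linarith))
          (closedBall_subset_closedBall (by linarith))

/-- An upper bound for the distance to `T` of the trees that are `1 / (k + 1)`-close to it. -/
def closeBound (T : SpatialTree.{u, v} M) (k : ℕ) : ℝ≥0∞ :=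
  ∫⁻ r in Ioi (0 : ℝ), ENNReal.ofReal (Real.exp (-r)) *
    min 1 (ENNReal.ofReal (5 * (1 / ((k : ℝ) + 1))) + if r ≤ k then
      T.μ (closedBall T.ρ (r + 2 * (1 / ((k : ℝ) + 1)))) -
        T.μ (closedBall T.ρ (r - 2 * (1 / ((k : ℝ) + 1)))) else 1)

theorem Close.delta_le_closeBound {T T' : SpatialTree.{u, v} M} [ProperSpace T.X] {k : ℕ}
    (h : Close T T' (1 / ((k : ℝ) + 1)) k) : delta T T' ≤ closeBound T k := by
  have hη : 0 < 1 / ((k : ℝ) + 1) := by positivity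
  have := T.locallyFinite
  refine setLIntegral_mono' measurableSet_Ioi fun r hr => ?_
  refine mul_le_mul_right ?_ _
  split_ifs with hk
  · refine min_le_min_left _ ((h.deltaC_restrict_le hr hk).trans ?_)
    rw [measure_sdiff (closedBall_subset_closedBall (by linarith))
      measurableSet_closedBall.nullMeasurableSet measure_closedBall_lt_top.ne]
  · exact le_min (min_le_left _ _) ((min_le_left _ _).trans le_add_self)

/-- The mass of balls is monotone in the radius, hence continuous at almost every `r`, and there the
mass of the annulus vanishes in the limit. Monotonicity also makes the integrand measurable; `exp
(-r)` dominates it. -/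
theorem tendsto_closeBound (T : SpatialTree.{u, v} M) [ProperSpace T.X] :
    Filter.Tendsto (closeBound T) Filter.atTop (nhds 0) := by
  have := T.locallyFinite
  set g : ℝ → ℝ≥0∞ := fun r => T.μ (closedBall T.ρ r) with hg
  have hmono : Monotone g := fun r s h => measure_mono (closedBall_subset_closedBall h)
  have hη : Filter.Tendsto (fun k : ℕ => 1 / ((k : ℝ) + 1)) Filter.atTop (nhds 0) :=
    tendsto_one_div_add_atTop_nhds_zero_nat
  have hexp : ∫⁻ r in Ioi (0 : ℝ), ENNReal.ofReal (Real.exp (-r)) ≠ ∞ := by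
    have := (integrableOn_exp_neg_Ioi 0).lintegral_lt_top
    exact this.ne
  have hz : ∫⁻ r in Ioi (0 : ℝ), (0 : ℝ≥0∞) = 0 := by simp
  rw [← hz]
  refine tendsto_lintegral_of_dominated_convergence
    (fun r => ENNReal.ofReal (Real.exp (-r))) (fun k => ?_) (fun k => ?_) hexp ?_
  · refine Measurable.mul (by fun_prop) (measurable_const.min (Measurable.const_add ?_ _))
    refine Measurable.ite measurableSet_Iic ?_ measurable_const
    exact (hmono.measurable.comp (measurable_id.add_const _)).sub
      (hmono.measurable.comp (measurable_id.sub_const _))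
  · exact Filter.Eventually.of_forall fun r => mul_le_of_le_one_right' (min_le_left _ _)
  · have hae : ∀ᵐ r : ℝ, ContinuousAt g r := by
      have := hmono.countable_not_continuousAt.ae_notMem volume
      filter_upwards [this] with r hr
      simpa using hr
    filter_upwards [ae_restrict_of_ae hae] with r hr
    have e1 : Filter.Tendsto (fun k : ℕ => g (r + 2 * (1 / ((k : ℝ) + 1)))) Filter.atTop
        (nhds (g r)) := by
      refine hr.tendsto.comp ?_
      simpa using (hη.const_mul 2).const_add r
    have e2 : Filter.Tendsto (fun k : ℕ => g (r - 2 * (1 / ((k : ℝ) + 1)))) Filter.atTop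
        (nhds (g r)) := by
      refine hr.tendsto.comp ?_
      simpa using (hη.const_mul 2).const_sub r
    have e3 := ENNReal.Tendsto.sub e1 e2 (Or.inl measure_closedBall_lt_top.ne)
    have e4 : Filter.Tendsto (fun k : ℕ => ENNReal.ofReal (5 * (1 / ((k : ℝ) + 1)))) Filter.atTop
        (nhds 0) := by
      simpa using ENNReal.tendsto_ofReal (hη.const_mul 5)
    have e5 := (ENNReal.Tendsto.const_mul ((tendsto_const_nhds (x := (1 : ℝ≥0∞))).min (e4.add e3))
      (Or.inr (ENNReal.ofReal_ne_top (r := Real.exp (-r)))))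
    simp only [tsub_self, add_zero, min_zero, mul_zero] at e5
    refine e5.congr' ?_
    filter_upwards [Filter.eventually_ge_atTop ⌈r⌉₊] with k hk
    rw [if_pos (Nat.ceil_le.1 hk)]

theorem tendsto_delta_of_close {ι : Type*} {l : Filter ι} (T : SpatialTree.{u, v} M)
    [ProperSpace T.X] (S : ι → SpatialTree.{u, v} M)
    (h : ∀ k : ℕ, ∀ᶠ i in l, Close T (S i) (1 / ((k : ℝ) + 1)) k) :
    Filter.Tendsto (fun i => delta T (S i)) l (nhds 0) := by
  rw [ENNReal.tendsto_nhds_zero]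
  intro ε hε
  obtain ⟨k, hk⟩ := ((tendsto_closeBound T).eventually (gt_mem_nhds hε)).exists
  filter_upwards [h k] with i hi
  exact hi.delta_le_closeBound.trans hk.le

end SpatialTree

/-! ### Uniformly bounded families of trees -/

/-- The constants in the hypotheses of the compactness criterion. -/
structure TreeBounds (M : Type v) where
  /-- bounds for the size of separated sets -/
  N : ℕ → ℕ
  /-- bounds for the masses of balls -/
  C : ℕ → ℝ≥0
  /-- moduli of continuity -/
  δ : ℕ → ℝ
  δ_pos : ∀ m, 0 < δ m
  /-- a base point -/
  m₀ : M
  /-- the radius of a ball that holds the images of the roots -/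
  R₀ : ℝ

namespace SpatialTree

open RootedSpace Filter Topology

variable {M : Type v} [MetricSpace M]

/-- A tree obeys the bounds `b`. The conditions are chosen so that they define a closed set. -/
structure Obeys (T : SpatialTree.{u, v} M) (b : TreeBounds M) : Prop where
  packing : ∀ (m : ℕ) (s : Finset T.X), (∀ x ∈ s, dist x T.ρ < m + 1) →
    (∀ x ∈ s, ∀ y ∈ s, x ≠ y → 1 / ((m : ℝ) + 1) < dist x y) → s.card ≤ b.N m
  mass : ∀ m : ℕ, T.μ (ball T.ρ (m + 1)) ≤ b.C m
  equi : ∀ (m : ℕ) (x y : T.X), dist x T.ρ < m + 1 → dist y T.ρ < m + 1 → dist x y < b.δ m →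
    dist (T.φ x) (T.φ y) ≤ 1 / ((m : ℝ) + 1)
  root : dist (T.φ T.ρ) b.m₀ ≤ b.R₀

/-- The ball of radius `R` in `T` can be mapped to `T'` with an error of order `ε`. -/
def Approx (T T' : SpatialTree.{u, v} M) (R ε : ℝ) : Prop :=
  (∃ f : T.X → T'.X,
    (∀ x, dist x T.ρ ≤ R →
      dist (f x) T'.ρ ≤ dist x T.ρ + 2 * ε ∧ dist (T.φ x) (T'.φ (f x)) ≤ ε) ∧
    ∀ x y, dist x T.ρ ≤ R → dist y T.ρ ≤ R → |dist (f x) (f y) - dist x y| ≤ 2 * ε) ∧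
  dist (T.φ T.ρ) (T'.φ T'.ρ) ≤ ε ∧
  ∀ s ≤ R, T.μ (closedBall T.ρ s) ≤ T'.μ (closedBall T'.ρ (s + 2 * ε)) + ENNReal.ofReal ε

theorem approx_of_deltaC_lt {T T' : SpatialTree.{u, v} M} {r : ℝ≥0} {ε : ℝ} (hε : 0 < ε)
    (h : (T.restrict r).deltaC (T'.restrict r) < ENNReal.ofReal ε) : Approx T T' r ε := by
  simp only [deltaC, iInf_lt_iff] at h
  obtain ⟨Z, _, ψ, ψ', D, hψ, hψ', hD, hρ, hlt⟩ := h
  have hP := le_self_add.trans_lt hlt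
  have hS := le_add_self.trans_lt hlt
  have hpair : ∀ p ∈ D, dist (ψ p.1) (ψ' p.2) ≤ ε ∧ dist (T.φ p.1.1) (T'.φ p.2.1) ≤ ε := by
    intro p hp
    have h1 := (le_iSup₂ (f := fun p _ => edist (ψ p.1) (ψ' p.2) +
      edist ((T.restrict r).φ p.1) ((T'.restrict r).φ p.2)) p hp).trans_lt hS
    rw [← edist_le_ofReal hε.le, ← edist_le_ofReal hε.le]
    exact ⟨le_self_add.trans h1.le, le_add_self.trans h1.le⟩
  choose k hk using hD.1
  have dψ : ∀ x y (hx : x ∈ closedBall T.ρ (r : ℝ)) (hy : y ∈ closedBall T.ρ (r : ℝ)),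
      dist (ψ ⟨x, hx⟩) (ψ ⟨y, hy⟩) = dist x y := fun x y hx hy => hψ.dist_eq _ _
  have dψ' : ∀ x y (hx : x ∈ closedBall T'.ρ (r : ℝ)) (hy : y ∈ closedBall T'.ρ (r : ℝ)),
      dist (ψ' ⟨x, hx⟩) (ψ' ⟨y, hy⟩) = dist x y := fun x y hx hy => hψ'.dist_eq _ _
  have h0 : T.ρ ∈ closedBall T.ρ (r : ℝ) := mem_closedBall_self r.coe_nonneg
  have h0' : T'.ρ ∈ closedBall T'.ρ (r : ℝ) := mem_closedBall_self r.coe_nonneg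
  have hρρ : dist (ψ ⟨T.ρ, h0⟩) (ψ' ⟨T'.ρ, h0'⟩) ≤ ε := (hpair _ hρ).1
  refine ⟨?_, (hpair _ hρ).2, ?_⟩
  · classical
    refine ⟨fun x => if h : x ∈ closedBall T.ρ (r : ℝ) then (k ⟨x, h⟩).1 else T'.ρ, ?_, ?_⟩
    · intro x hx
      have hx : x ∈ closedBall T.ρ (r : ℝ) := hx
      have h1 := hpair _ (hk ⟨x, hx⟩)
      simp only [dif_pos hx]
      refine ⟨?_, h1.2⟩
      have h2 := dist_triangle4 (ψ' (k ⟨x, hx⟩)) (ψ ⟨x, hx⟩) (ψ ⟨T.ρ, h0⟩) (ψ' ⟨T'.ρ, h0'⟩)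
      have h3 : dist (ψ' (k ⟨x, hx⟩)) (ψ' ⟨T'.ρ, h0'⟩) = dist (k ⟨x, hx⟩).1 T'.ρ :=
        hψ'.dist_eq _ _
      rw [h3, dψ, dist_comm (ψ' _)] at h2
      linarith [h1.1]
    · intro x y hx hy
      have hx : x ∈ closedBall T.ρ (r : ℝ) := hx
      have hy : y ∈ closedBall T.ρ (r : ℝ) := hy
      have h1 := (hpair _ (hk ⟨x, hx⟩)).1
      have h2 := (hpair _ (hk ⟨y, hy⟩)).1
      simp only [dif_pos hx, dif_pos hy]
      have h3 : dist (ψ' (k ⟨x, hx⟩)) (ψ' (k ⟨y, hy⟩)) = dist (k ⟨x, hx⟩).1 (k ⟨y, hy⟩).1 :=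
        hψ'.dist_eq _ _
      rw [← h3, ← dψ x y hx hy, abs_le]
      dsimp only at h1 h2
      constructor
      · linarith [dist_triangle4 (ψ ⟨x, hx⟩) (ψ' (k ⟨x, hx⟩)) (ψ' (k ⟨y, hy⟩)) (ψ ⟨y, hy⟩),
          dist_comm (ψ ⟨y, hy⟩) (ψ' (k ⟨y, hy⟩))]
      · linarith [dist_triangle4 (ψ' (k ⟨x, hx⟩)) (ψ ⟨x, hx⟩) (ψ ⟨y, hy⟩) (ψ' (k ⟨y, hy⟩)),
          dist_comm (ψ ⟨x, hx⟩) (ψ' (k ⟨x, hx⟩))]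
  · intro s hs
    let _ : MeasurableSpace Z := _root_.borel Z
    have : BorelSpace Z := ⟨rfl⟩
    -- The enlargement by `2 * ε` is one `ε` for the thickening and one for the distance between the
    -- roots.
    have key := left_measure_le_of_levyProkhorovEDist_lt hP
      (B := closedBall (ψ ⟨T.ρ, h0⟩) s) measurableSet_closedBall
    rw [map_restrict_apply T.toRootedSpace _ hψ.continuous measurableSet_closedBall,
      map_restrict_apply T'.toRootedSpace _ hψ'.continuous isOpen_thickening.measurableSet,
      ENNReal.toReal_ofReal hε.le] at key
    refine (measure_mono ?_).trans (key.trans (add_le_add_left (measure_mono ?_) _))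
    · intro x hx
      refine ⟨closedBall_subset_closedBall hs hx, ?_⟩
      rw [mem_closedBall, dψ]
      exact hx
    · rintro y ⟨hy, hyt⟩
      obtain ⟨z, hz, hyz⟩ := mem_thickening_iff.1 hyt
      rw [mem_closedBall] at hz ⊢
      rw [← dψ' y _ hy h0']
      linarith [dist_triangle4 (ψ' ⟨y, hy⟩) z (ψ ⟨T.ρ, h0⟩) (ψ' ⟨T'.ρ, h0'⟩)]

theorem Approx.mono {T T' : SpatialTree.{u, v} M} {R R' ε : ℝ} (h : Approx T T' R' ε)
    (hR : R ≤ R') : Approx T T' R ε := by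
  obtain ⟨⟨f, h1, h2⟩, h3, h4⟩ := h
  exact ⟨⟨f, fun x hx => h1 x (hx.trans hR), fun x y hx hy => h2 x y (hx.trans hR) (hy.trans hR)⟩,
    h3, fun s hs => h4 s (hs.trans hR)⟩

/-- If `Δ_c` were at least `ε` at every radius in `(R, R + 1]`, this interval alone would contribute
`exp (-(R + 1)) * ε` to `Δ`. -/
theorem exists_pos_forall_delta_lt_approx (T : SpatialTree.{u, v} M) {R ε : ℝ} (hR : 0 ≤ R)
    (hε : 0 < ε) (hε1 : ε ≤ 1) :
    ∃ c : ℝ≥0∞, 0 < c ∧ ∀ T', delta T T' < c → Approx T T' R ε := by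
  refine ⟨ENNReal.ofReal (Real.exp (-(R + 1))) * ENNReal.ofReal ε,
    ENNReal.mul_pos (by simp [Real.exp_pos]) (by simpa using hε), fun T' hT' => ?_⟩
  have : ∃ r ∈ Ioc R (R + 1),
      (T.restrict r.toNNReal).deltaC (T'.restrict r.toNNReal) < ENNReal.ofReal ε := by
    by_contra! hcon
    refine hT'.not_ge ?_
    calc ENNReal.ofReal (Real.exp (-(R + 1))) * ENNReal.ofReal ε
        = ∫⁻ _ in Ioc R (R + 1), ENNReal.ofReal (Real.exp (-(R + 1))) * ENNReal.ofReal ε := by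
          simp
      _ ≤ ∫⁻ r in Ioc R (R + 1), ENNReal.ofReal (Real.exp (-r)) *
            min 1 ((T.restrict r.toNNReal).deltaC (T'.restrict r.toNNReal)) := by
          refine setLIntegral_mono' measurableSet_Ioc fun r hr => ?_
          gcongr
          · exact hr.2
          · exact le_min (by simpa using hε1) (hcon r hr)
      _ ≤ delta T T' := lintegral_mono_set fun r hr => hR.trans_lt hr.1
  obtain ⟨r, hr, hlt⟩ := this
  refine (approx_of_deltaC_lt hε hlt).mono ?_
  rw [Real.coe_toNNReal r (hR.trans hr.1.le)]
  exact hr.1.le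

theorem Equivalent.approx {T T' : SpatialTree.{u, v} M} (h : Equivalent T T') {R ε : ℝ}
    (hε : 0 < ε) : Approx T T' R ε := by
  obtain ⟨π, hμ, hφ, hρ⟩ := h
  refine ⟨⟨π, fun x _ => ⟨?_, ?_⟩, fun x y _ _ => ?_⟩, ?_, fun s _ => ?_⟩
  · rw [← hρ, π.isometry.dist_eq]; linarith
  · rw [hφ, dist_self]; exact hε.le
  · rw [π.isometry.dist_eq, sub_self, abs_zero]; linarith
  · rw [hφ, hρ, dist_self]; exact hε.le
  · rw [← hμ, Measure.map_apply π.continuous.measurable measurableSet_closedBall]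
    refine le_add_right (measure_mono fun x hx => ?_)
    rw [mem_closedBall] at hx
    rw [mem_preimage, ← hρ, mem_closedBall, π.isometry.dist_eq]
    linarith

/-- The strict hypotheses in `Obeys` survive a transport with small error, and the non-strict
conclusions pass to the limit `ε → 0`. -/
theorem obeys_of_approx {T : SpatialTree.{u, v} M} {b : TreeBounds M}
    (h : ∀ R ε : ℝ, 0 ≤ R → 0 < ε → ε ≤ 1 → ∃ T' : SpatialTree.{u, v} M,
      T'.Obeys b ∧ Approx T T' R ε) : T.Obeys b := by
  have hev : ∀ R : ℝ, 0 ≤ R → ∀ᶠ ε in 𝓝[>] (0 : ℝ), ∃ T' : SpatialTree.{u, v} M,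
      T'.Obeys b ∧ Approx T T' R ε := by
    intro R hR
    filter_upwards [Ioc_mem_nhdsGT (zero_lt_one' ℝ)] with ε hε
    exact h R ε hR hε.1 hε.2
  have hpos : ∀ᶠ ε in 𝓝[>] (0 : ℝ), 0 < ε := self_mem_nhdsWithin
  have hlin : ∀ a : ℝ, Tendsto (fun ε : ℝ => a + 2 * ε) (𝓝[>] 0) (𝓝 a) := by
    intro a
    refine tendsto_nhdsWithin_of_tendsto_nhds ?_
    exact (Continuous.tendsto' (by fun_prop) _ _ (by simp))
  have hsmall : ∀ {a c : ℝ}, a < c → ∀ᶠ ε in 𝓝[>] (0 : ℝ), a + 2 * ε < c := fun h =>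
    (hlin _).eventually (gt_mem_nhds h)
  refine ⟨?_, ?_, ?_, ?_⟩
  · intro m s hs hsep
    have h1 : ∀ᶠ ε in 𝓝[>] (0 : ℝ), ∀ x ∈ s, dist x T.ρ + 2 * ε < m + 1 :=
      (Finset.eventually_all _).2 fun x hx => hsmall (hs x hx)
    have h2 : ∀ᶠ ε in 𝓝[>] (0 : ℝ), ∀ x ∈ s, ∀ y ∈ s, x ≠ y →
        1 / ((m : ℝ) + 1) + 2 * ε < dist x y := by
      refine (Finset.eventually_all _).2 fun x hx => (Finset.eventually_all _).2 fun y hy => ?_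
      by_cases hxy : x = y
      · simp [hxy]
      · filter_upwards [hsmall (hsep x hx y hy hxy)] with ε hε _ using hε
    obtain ⟨ε, h1, h2, ⟨T', hT', ⟨f, hf1, hf2⟩, -⟩⟩ :=
      (h1.and (h2.and (hev (m + 1) (by positivity)))).exists
    classical
    have hle : ∀ x ∈ s, dist x T.ρ ≤ (m : ℝ) + 1 := fun x hx => (hs x hx).le
    have hsep' : ∀ x ∈ s, ∀ y ∈ s, x ≠ y → 1 / ((m : ℝ) + 1) < dist (f x) (f y) := by
      intro x hx y hy hxy
      have := abs_le.1 (hf2 x y (hle x hx) (hle y hy))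
      linarith [h2 x hx y hy hxy]
    have hinj : Set.InjOn f s := by
      intro x hx y hy hxy
      by_contra hne
      have := hsep' x hx y hy hne
      rw [hxy, dist_self] at this
      exact this.not_ge (by positivity)
    rw [← Finset.card_image_of_injOn hinj]
    refine hT'.packing m _ ?_ ?_
    · intro z hz
      obtain ⟨x, hx, rfl⟩ := Finset.mem_image.1 hz
      exact (hf1 x (hle x hx)).1.trans_lt (h1 x hx)
    · intro z hz w hw hzw
      obtain ⟨x, hx, rfl⟩ := Finset.mem_image.1 hz
      obtain ⟨y, hy, rfl⟩ := Finset.mem_image.1 hw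
      exact hsep' x hx y hy fun e => hzw (by rw [e])
  · intro m
    have hcl : ∀ s : ℝ, s < m + 1 → T.μ (closedBall T.ρ s) ≤ b.C m := by
      intro s hs
      have hlim : Tendsto (fun ε : ℝ => (b.C m : ℝ≥0∞) + ENNReal.ofReal ε) (𝓝[>] 0)
          (𝓝 (b.C m)) := by
        refine tendsto_nhdsWithin_of_tendsto_nhds (Continuous.tendsto' ?_ _ _ (by simp))
        exact continuous_const.add ENNReal.continuous_ofReal
      refine ge_of_tendsto hlim ?_
      filter_upwards [hsmall hs, hev (m + 1) (by positivity)] with ε h1 ⟨T', hT', _, _, hm⟩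
      refine (hm s hs.le).trans (add_le_add_left (le_trans (measure_mono ?_) (hT'.mass m)) _)
      exact closedBall_subset_ball h1
    -- The comparison enlarges radii, so it reaches only closed balls of radius below `m + 1`; the
    -- open ball is their increasing union.
    have hun : ball T.ρ ((m : ℝ) + 1) = ⋃ n : ℕ, closedBall T.ρ (m + 1 - 1 / ((n : ℝ) + 1)) := by
      ext x
      simp only [mem_iUnion, mem_ball, mem_closedBall]
      constructor
      · intro hx
        obtain ⟨n, hn⟩ := exists_nat_one_div_lt (sub_pos.2 hx)
        exact ⟨n, by linarith⟩
      · rintro ⟨n, hn⟩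
        have : 0 < 1 / ((n : ℝ) + 1) := by positivity
        linarith
    rw [hun, Monotone.measure_iUnion]
    · refine iSup_le fun n => hcl _ ?_
      have : 0 < 1 / ((n : ℝ) + 1) := by positivity
      linarith
    · intro n n' hn
      refine closedBall_subset_closedBall ?_
      have := one_div_le_one_div_of_le (by positivity : (0 : ℝ) < n + 1)
        (by exact_mod_cast Nat.succ_le_succ hn : (n : ℝ) + 1 ≤ n' + 1)
      linarith
  · intro m x y hx hy hxy
    refine ge_of_tendsto (hlin _) ?_
    filter_upwards [hsmall hx, hsmall hy, hsmall hxy, hev (m + 1) (by positivity)] with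
      ε h1 h2 h3 ⟨T', hT', ⟨f, hf1, hf2⟩, _⟩
    have e1 := hf1 x hx.le
    have e2 := hf1 y hy.le
    have e3 := abs_le.1 (hf2 x y hx.le hy.le)
    have e4 := hT'.equi m (f x) (f y) (by linarith) (by linarith) (by linarith)
    linarith [dist_triangle4 (T.φ x) (T'.φ (f x)) (T'.φ (f y)) (T.φ y),
      dist_comm (T.φ y) (T'.φ (f y))]
  · refine ge_of_tendsto (hlin _) ?_
    filter_upwards [hpos, hev 0 le_rfl] with ε hε ⟨T', hT', _, h1, _⟩
    linarith [dist_triangle (T.φ T.ρ) (T'.φ T'.ρ) b.m₀, hT'.root]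

theorem isClosed_obeys (b : TreeBounds M) : IsClosed {T : SpatialTree.{u, v} M | T.Obeys b} := by
  rw [← isOpen_compl_iff]
  intro T hT
  by_contra! hcon
  refine hT (obeys_of_approx fun R ε hR hε hε1 => ?_)
  obtain ⟨c, hc, happ⟩ := T.exists_pos_forall_delta_lt_approx hR hε hε1
  obtain ⟨T', h1, h2⟩ := hcon c hc
  exact ⟨T', not_not.1 h2, happ T' h1⟩

theorem Obeys.of_equivalent {T T' : SpatialTree.{u, v} M} {b : TreeBounds M} (h : T'.Obeys b)
    (he : Equivalent T T') : T.Obeys b :=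
  obeys_of_approx fun _ _ _ hε _ => ⟨T', h, he.approx hε⟩

theorem exists_bounds (A : Set (SpatialTree.{u, v} M)) (hA : A.Nonempty)
    (cover : ∀ r : ℝ, 0 < r → ∀ ε : ℝ≥0, 0 < ε → ∃ N : ℕ, ∀ T ∈ A,
      ∃ s : Finset T.X, s.card < N ∧ IsCover ε (T.rootBall r) (s : Set T.X))
    (mass : ∀ r : ℝ, 0 < r → (⨆ T ∈ A, T.μ (T.rootBall r)) < ∞)
    (root : Bornology.IsBounded {m : M | ∃ T ∈ A, m = T.φ T.ρ})
    (equi : ∀ r : ℝ, 0 < r → ∀ ε : ℝ≥0, 0 < ε → ∃ δ : ℝ, 0 < δ ∧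
      (⨆ T ∈ A, ⨆ (x ∈ T.rootBall r) (y ∈ T.rootBall r) (_ : dist x y ≤ δ),
        edist (T.φ x) (T.φ y)) < ε) :
    ∃ b : TreeBounds M, ∀ T ∈ A, T.Obeys b := by
  obtain ⟨T₀, hT₀⟩ := hA
  obtain ⟨R₀, hR₀⟩ := root.subset_closedBall (T₀.φ T₀.ρ)
  have hm : ∀ m : ℕ, (0 : ℝ) < m + 1 := fun m => by positivity
  -- Covers at half the separation scale: two distinct separated points cannot share a centre, so
  -- separated sets inject into covers.
  choose N hN using fun m : ℕ => cover (m + 1) (hm m) (1 / (2 * (m + 1))) (by positivity)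
  choose δ hδ hδ' using fun m : ℕ => equi (m + 1) (hm m) (1 / (m + 1)) (by positivity)
  refine ⟨⟨N, fun m => (⨆ T ∈ A, T.μ (T.rootBall ((m : ℝ) + 1))).toNNReal, δ, hδ,
    T₀.φ T₀.ρ, R₀⟩, fun T hT => ⟨?_, ?_, ?_, ?_⟩⟩
  · intro m s hs hsep
    obtain ⟨t, ht, hcov⟩ := hN m T hT
    have : ∀ x ∈ s, ∃ y ∈ t, dist x y ≤ 1 / (2 * ((m : ℝ) + 1)) := by
      intro x hx
      obtain ⟨y, hy, hxy⟩ := hcov (show x ∈ T.rootBall ((m : ℝ) + 1) from (hs x hx).le)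
      refine ⟨y, hy, ?_⟩
      have hxy : edist x y ≤ ((1 / (2 * (m + 1)) : ℝ≥0) : ℝ≥0∞) := hxy
      rw [edist_nndist, ENNReal.coe_le_coe] at hxy
      simpa using NNReal.coe_le_coe.2 hxy
    choose! f hf hf' using this
    refine (Finset.card_le_card_of_injOn f hf ?_).trans ht.le
    intro x hx y hy hxy
    by_contra hne
    have h1 := hsep x hx y hy hne
    have h2 := hf' x hx
    have h3 := hf' y hy
    rw [← hxy] at h3
    have h4 : 1 / ((m : ℝ) + 1) = 1 / (2 * ((m : ℝ) + 1)) + 1 / (2 * ((m : ℝ) + 1)) := by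
      field_simp
      norm_num
    linarith [dist_triangle_right x y (f x)]
  · intro m
    rw [ENNReal.coe_toNNReal (mass _ (hm m)).ne]
    exact (measure_mono ball_subset_closedBall).trans
      (le_iSup₂ (f := fun (T : SpatialTree.{u, v} M) (_ : T ∈ A) =>
        T.μ (T.rootBall ((m : ℝ) + 1))) T hT)
  · intro m x y hx hy hxy
    have h1 : edist (T.φ x) (T.φ y) < ((1 / (m + 1) : ℝ≥0) : ℝ≥0∞) := by
      refine lt_of_le_of_lt ?_ (hδ' m)
      refine le_iSup₂_of_le T hT (le_iSup₂_of_le x hx.le (le_iSup₂_of_le y hy.le ?_))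
      exact le_iSup_of_le hxy.le le_rfl
    rw [edist_nndist, ENNReal.coe_lt_coe] at h1
    simpa using (NNReal.coe_lt_coe.2 h1).le
  · exact hR₀ ⟨T, hT, rfl⟩

end SpatialTree

/-! ### The limit space along an ultrafilter -/

section UltraLimit

open Filter Topology

theorem exists_ultralimit_space {I : Type*} (F : Ultrafilter I) {J : Type u} (Y : I → Type*)
    [∀ i, MetricSpace (Y i)] (x : ∀ i, J → Y i)
    (hb : ∀ p q, ∃ B, ∀ i, dist (x i p) (x i q) ≤ B) :
    ∃ (X : Type u) (_ : MetricSpace X) (z : J → X), CompleteSpace X ∧ DenseRange z ∧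
      ∀ p q, Tendsto (fun i => dist (x i p) (x i q)) F (𝓝 (dist (z p) (z q))) := by
  have hlim : ∀ p q, ∃ a, Tendsto (fun i => dist (x i p) (x i q)) F (𝓝 a) := by
    intro p q
    obtain ⟨B, hB⟩ := hb p q
    obtain ⟨a, -, ha⟩ := F.exists_tendsto_of_eventually_mem (isCompact_Icc (a := (0 : ℝ)) (b := B))
      (Eventually.of_forall fun i => ⟨dist_nonneg, hB i⟩)
    exact ⟨a, ha⟩
  choose d hd using hlim
  let _ : PseudoMetricSpace J :=
    { dist := d
      dist_self := fun p => tendsto_nhds_unique (hd p p) (by simp)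
      dist_comm := fun p q => tendsto_nhds_unique (hd p q) (by simpa only [dist_comm] using hd q p)
      dist_triangle := fun p q r => le_of_tendsto_of_tendsto' (hd p r) ((hd p q).add (hd q r))
        fun i => dist_triangle _ _ _ }
  -- The completion also identifies points at limit distance zero.
  refine ⟨UniformSpace.Completion J, inferInstance, (↑), inferInstance,
    UniformSpace.Completion.denseRange_coe, fun p q => ?_⟩
  rw [UniformSpace.Completion.dist_eq]
  exact hd p q

theorem exists_continuous_extension {J X M : Type*} [MetricSpace X] [MetricSpace M]
    [CompleteSpace M] {z : J → X} (hz : DenseRange z) {φ : J → M}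
    (h : ∀ x : X, ∀ ε > 0, ∃ δ > 0, ∀ p q, dist (z p) x < δ → dist (z q) x < δ →
      dist (φ p) (φ q) ≤ ε) :
    ∃ Φ : X → M, Continuous Φ ∧ ∀ p, Φ (z p) = φ p := by
  -- `z` need not be injective; `h` at `x = z p` forces `φ` to be constant on its fibres.
  let _ : TopologicalSpace J := TopologicalSpace.induced z inferInstance
  have hi : IsDenseInducing z := ⟨⟨rfl⟩, hz⟩
  have hlim : ∀ x, ∃ c, Tendsto φ (comap z (𝓝 x)) (𝓝 c) := by
    intro x
    have := hi.comap_nhds_neBot x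
    refine cauchy_map_iff_exists_tendsto.1 (Metric.cauchy_iff.2 ⟨inferInstance, fun ε hε => ?_⟩)
    obtain ⟨δ, hδ, H⟩ := h x (ε / 2) (half_pos hε)
    refine ⟨φ '' (z ⁻¹' ball x δ), image_mem_map (preimage_mem_comap (ball_mem_nhds _ hδ)), ?_⟩
    rintro _ ⟨p, hp, rfl⟩ _ ⟨q, hq, rfl⟩
    exact (H p q hp hq).trans_lt (half_lt_self hε)
  exact ⟨hi.extend φ, hi.continuous_extend hlim, hi.extend_eq' hlim⟩

end UltraLimit

namespace SpatialTree

open RootedSpace Filter Topology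

variable {M : Type v} [MetricSpace M]

/-- A separated set of the largest possible size is a net, since a point far from it could be added.
-/
theorem Obeys.exists_finset_net {T : SpatialTree.{u, v} M} {b : TreeBounds M} (h : T.Obeys b)
    (m : ℕ) : ∃ s : Finset T.X, s.card ≤ b.N m ∧ (∀ x ∈ s, dist x T.ρ < m + 1) ∧
      ∀ y, dist y T.ρ < m + 1 → ∃ x ∈ s, dist y x ≤ 1 / ((m : ℝ) + 1) := by
  classical
  let P : Finset T.X → Prop := fun s => (∀ x ∈ s, dist x T.ρ < m + 1) ∧
    ∀ x ∈ s, ∀ y ∈ s, x ≠ y → 1 / ((m : ℝ) + 1) < dist x y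
  have hne : {n | ∃ s, P s ∧ s.card = n}.Nonempty := ⟨0, ∅, by simp [P]⟩
  have hbdd : BddAbove {n | ∃ s, P s ∧ s.card = n} := by
    refine ⟨b.N m, ?_⟩
    rintro _ ⟨s, hs, rfl⟩
    exact h.packing m s hs.1 hs.2
  obtain ⟨s, hs, hcard⟩ := Nat.sSup_mem hne hbdd
  refine ⟨s, h.packing m s hs.1 hs.2, hs.1, fun y hy => ?_⟩
  by_contra! hcon
  have hys : y ∉ s := fun hys => by
    have := hcon y hys
    rw [dist_self] at this
    exact this.not_ge (by positivity)
  have hP : P (insert y s) := by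
    refine ⟨fun x hx => ?_, fun x hx w hw hxw => ?_⟩
    · rcases Finset.mem_insert.1 hx with rfl | hx
      exacts [hy, hs.1 x hx]
    · rcases Finset.mem_insert.1 hx with rfl | hx' <;>
        rcases Finset.mem_insert.1 hw with rfl | hw'
      · exact absurd rfl hxw
      · exact hcon w hw'
      · rw [dist_comm]; exact hcon x hx'
      · exact hs.2 x hx' w hw' hxw
  have := le_csSup hbdd ⟨insert y s, hP, rfl⟩
  rw [Finset.card_insert_of_notMem hys, ← hcard] at this
  omega

theorem Obeys.exists_net {T : SpatialTree.{u, v} M} {b : TreeBounds M} (h : T.Obeys b) :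
    ∃ x : ℕ × ℕ → T.X, (∀ m, x (m, 0) = T.ρ) ∧ (∀ m j, dist (x (m, j)) T.ρ < m + 1) ∧
      ∀ (m : ℕ) y, dist y T.ρ < m + 1 → ∃ j ≤ b.N m, dist y (x (m, j)) ≤ 1 / ((m : ℝ) + 1) := by
  choose s hcard hlt hnet using h.exists_finset_net
  let e : ∀ m j, j < (s m).card → T.X := fun m j hj => ((s m).equivFin.symm ⟨j, hj⟩).1
  -- Index `0` is reserved for the root at every scale and surplus indices repeat the root, so the
  -- net occupies indices up to and including `b.N m`.
  let x : ℕ × ℕ → T.X := fun p => match p with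
    | (_, 0) => T.ρ
    | (m, j + 1) => if hj : j < (s m).card then e m j hj else T.ρ
  have hρ : ∀ m : ℕ, dist T.ρ T.ρ < (m : ℝ) + 1 := fun m => by rw [dist_self]; positivity
  refine ⟨x, fun m => rfl, fun m j => ?_, fun m y hy => ?_⟩
  · cases j with
    | zero => exact hρ m
    | succ j =>
      simp only [x]
      split_ifs with hj
      · exact hlt m _ ((s m).equivFin.symm ⟨j, hj⟩).2
      · exact hρ m
  · obtain ⟨w, hw, hyw⟩ := hnet m y hy
    have hj : ((s m).equivFin ⟨w, hw⟩).1 < (s m).card := ((s m).equivFin ⟨w, hw⟩).2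
    refine ⟨((s m).equivFin ⟨w, hw⟩).1 + 1, (Nat.succ_le_of_lt hj).trans (hcard m), ?_⟩
    have : x (m, ((s m).equivFin ⟨w, hw⟩).1 + 1) = w := by
      simp only [x, e, dif_pos hj, Fin.eta, Equiv.symm_apply_apply]
    rwa [this]

/-- Walk to the root in `n` steps of length at most `b.δ m / 2`, each of which moves the image by at
most `1 / (m + 1)`. With the bound on the images of the roots, this confines the images of balls to
fixed compact sets. -/
theorem Obeys.dist_map_root_le {T : SpatialTree.{u, v} M} {b : TreeBounds M} (h : T.Obeys b)
    (m n : ℕ) (x : T.X) (hx : dist x T.ρ < m + 1) (hn : dist x T.ρ ≤ n * (b.δ m / 2)) :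
    dist (T.φ x) (T.φ T.ρ) ≤ n * (1 / ((m : ℝ) + 1)) := by
  induction n generalizing x with
  | zero =>
    have : x = T.ρ := dist_le_zero.1 (by simpa using hn)
    simp [this]
  | succ n ih =>
    have hδ := b.δ_pos m
    -- The minimum keeps `y` no farther from the root than `x`, hence in the ball where `equi`
    -- applies.
    obtain ⟨y, hy, hxy⟩ := T.exists_mem_closedBall_dist_le (r := min (n * (b.δ m / 2)) (dist x T.ρ))
      (s := b.δ m / 2) (le_min (by positivity) dist_nonneg) (by positivity) (y := x) (by
        rcases min_choice (n * (b.δ m / 2)) (dist x T.ρ) with h | h <;> rw [h]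
        · push_cast at hn
          linarith
        · linarith)
    rw [mem_closedBall, le_min_iff] at hy
    have h1 := ih y (hy.2.trans_lt hx) hy.1
    have h2 := h.equi m x y hx (hy.2.trans_lt hx) (by linarith)
    push_cast
    linarith [dist_triangle (T.φ x) (T.φ y) (T.φ T.ρ)]

/-- A complete space with a dense family of points, whose mutual distances are the limits of those
of nets in the trees `S i`. -/
structure LimitSpace {I : Type*} (F : Ultrafilter I) (S : I → SpatialTree.{u, v} M)
    (b : TreeBounds M) where
  /-- the limit space -/
  X : Type u
  [metric : MetricSpace X]
  complete : CompleteSpace X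
  /-- the points of the nets -/
  x : ∀ i, ℕ × ℕ → (S i).X
  /-- the limits of the points of the nets -/
  z : ℕ × ℕ → X
  dense : DenseRange z
  x_root : ∀ i m, x i (m, 0) = (S i).ρ
  x_lt : ∀ i m j, dist (x i (m, j)) (S i).ρ < m + 1
  x_net : ∀ i (m : ℕ) y, dist y (S i).ρ < m + 1 →
    ∃ j ≤ b.N m, dist y (x i (m, j)) ≤ 1 / ((m : ℝ) + 1)
  tendsto_dist : ∀ p q, Tendsto (fun i => dist (x i p) (x i q)) F (𝓝 (dist (z p) (z q)))

attribute [instance] LimitSpace.metric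

theorem nonempty_limitSpace {I : Type*} (F : Ultrafilter I) (S : I → SpatialTree.{u, v} M)
    (b : TreeBounds M) (hS : ∀ i, (S i).Obeys b) : Nonempty (LimitSpace F S b) := by
  choose x h1 h2 h3 using fun i => (hS i).exists_net
  -- Lifting the index set puts the limit space in the universe of the trees.
  obtain ⟨X, _, z, hc, hd, ht⟩ := exists_ultralimit_space F (J := ULift.{u} (ℕ × ℕ))
    (fun i => (S i).X) (fun i p => x i p.down) (by
      intro p q
      refine ⟨(p.down.1 + 1) + (q.down.1 + 1), fun i => ?_⟩
      exact (dist_triangle_right _ _ (S i).ρ).trans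
        (add_le_add (h2 i p.down.1 p.down.2).le (h2 i q.down.1 q.down.2).le))
  refine ⟨⟨X, hc, x, fun p => z ⟨p⟩, ?_, h1, h2, h3, fun p q => ht ⟨p⟩ ⟨q⟩⟩⟩
  exact hd.comp (f := fun p => (⟨p⟩ : ULift.{u} (ℕ × ℕ)))
    (Function.Surjective.denseRange fun p => ⟨p.down, rfl⟩) continuous_of_discreteTopology

namespace LimitSpace

variable {I : Type*} {F : Ultrafilter I} {S : I → SpatialTree.{u, v} M} {b : TreeBounds M}
  (D : LimitSpace F S b)

/-- The root of the limit space. -/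
def root : D.X := D.z (0, 0)

theorem z_root (m : ℕ) : D.z (m, 0) = D.root := by
  refine dist_eq_zero.1 (tendsto_nhds_unique (D.tendsto_dist _ _) ?_)
  simp [D.x_root]

theorem tendsto_dist_root (p : ℕ × ℕ) :
    Tendsto (fun i => dist (D.x i p) (S i).ρ) F (𝓝 (dist (D.z p) D.root)) := by
  simpa only [D.x_root, D.z_root] using D.tendsto_dist p (0, 0)

theorem eventually_root_lt {p : ℕ × ℕ} {c : ℝ} (h : dist (D.z p) D.root < c) :
    ∀ᶠ i in F, dist (D.x i p) (S i).ρ < c :=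
  (D.tendsto_dist_root p).eventually (gt_mem_nhds h)

theorem exists_dist_z_lt (y : D.X) {ε : ℝ} (hε : 0 < ε) : ∃ p, dist y (D.z p) < ε :=
  D.dense.exists_dist_lt y hε

/-- The nearby index in `S i` depends on `i` but takes finitely many values, so the ultrafilter
selects one. One half of the error is for replacing `y` by some `D.z p`. -/
theorem net (m : ℕ) (y : D.X) (hy : dist y D.root < m + 1) :
    ∃ j ≤ b.N m, dist y (D.z (m, j)) ≤ 2 * (1 / ((m : ℝ) + 1)) := by
  have hm : 0 < 1 / ((m : ℝ) + 1) := by positivity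
  obtain ⟨p, hp⟩ := D.exists_dist_z_lt y (lt_min hm (sub_pos.2 hy))
  obtain ⟨hp1, hp2⟩ := lt_min_iff.1 hp
  have hpr : dist (D.z p) D.root < m + 1 := by
    linarith [dist_triangle_left (D.z p) D.root y]
  have hev : ∀ᶠ i in F, ∃ j ∈ Iic (b.N m), dist (D.x i p) (D.x i (m, j)) ≤ 1 / ((m : ℝ) + 1) := by
    filter_upwards [D.eventually_root_lt hpr] with i hi
    exact D.x_net i m _ hi
  obtain ⟨j, hj, hjev⟩ := (Ultrafilter.eventually_exists_mem_iff (finite_Iic _)).1 hev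
  refine ⟨j, hj, ?_⟩
  have := le_of_tendsto (D.tendsto_dist p (m, j)) hjev
  linarith [dist_triangle y (D.z p) (D.z (m, j))]

theorem properSpace : ProperSpace D.X := by
  have := D.complete
  have hcpt : ∀ R, IsCompact (closedBall D.root R) := by
    intro R
    refine TotallyBounded.isCompact_of_isClosed (Metric.totallyBounded_iff.2 fun ε hε => ?_)
      isClosed_closedBall
    obtain ⟨m₁, hm₁⟩ := exists_nat_gt R
    obtain ⟨m₂, hm₂⟩ := exists_nat_one_div_lt (half_pos hε)
    set m := max m₁ m₂
    refine ⟨(fun j => D.z (m, j)) '' Iic (b.N m), (finite_Iic _).image _, fun y hy => ?_⟩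
    have e1 : (m₁ : ℝ) ≤ m := by exact_mod_cast le_max_left m₁ m₂
    have e2 : 1 / ((m : ℝ) + 1) ≤ 1 / ((m₂ : ℝ) + 1) := by
      gcongr
      exact le_max_right m₁ m₂
    rw [mem_closedBall] at hy
    obtain ⟨j, hj, hyj⟩ := D.net m y (by linarith)
    simp only [mem_iUnion]
    exact ⟨_, ⟨j, hj, rfl⟩, by rw [mem_ball]; linarith⟩
  refine ⟨fun y r => (hcpt (r + dist y D.root)).of_isClosed_subset isClosed_closedBall ?_⟩
  exact closedBall_subset_closedBall' le_rfl

theorem fourPoint : FourPoint D.X := by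
  have hz : ∀ p q r s, dist (D.z p) (D.z q) + dist (D.z r) (D.z s) ≤
      max (dist (D.z p) (D.z r) + dist (D.z q) (D.z s))
        (dist (D.z p) (D.z s) + dist (D.z q) (D.z r)) := fun p q r s =>
    le_of_tendsto_of_tendsto' ((D.tendsto_dist p q).add (D.tendsto_dist r s))
      (((D.tendsto_dist p r).add (D.tendsto_dist q s)).max
        ((D.tendsto_dist p s).add (D.tendsto_dist q r)))
      fun i => (S i).realTree.fourPoint _ _ _ _
  intro a b c d
  refine D.dense.induction_on a (isClosed_le (by fun_prop) (by fun_prop)) fun p => ?_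
  refine D.dense.induction_on b (isClosed_le (by fun_prop) (by fun_prop)) fun q => ?_
  refine D.dense.induction_on c (isClosed_le (by fun_prop) (by fun_prop)) fun r => ?_
  exact D.dense.induction_on d (isClosed_le (by fun_prop) (by fun_prop)) fun s => hz p q r s

/-- Intermediate points of geodesics in `S i` are rounded to a net of fixed scale; the ultrafilter
then selects a single index, whose limit is the required point. -/
theorem exists_almost_between (a c : D.X) {t : ℝ} (ht : t ∈ Icc 0 (dist a c)) {ε : ℝ}
    (hε : 0 < ε) : ∃ y, dist a y ≤ t + 2 * ε ∧ dist y c ≤ dist a c - t + 4 * ε := by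
  obtain ⟨p, hp⟩ := D.exists_dist_z_lt a hε
  obtain ⟨q, hq⟩ := D.exists_dist_z_lt c hε
  obtain ⟨m₁, hm₁⟩ := exists_nat_gt (dist (D.z p) D.root + t)
  obtain ⟨m₂, hm₂⟩ := exists_nat_one_div_lt hε
  set m := max m₁ m₂
  have e1 : (m₁ : ℝ) ≤ m := by exact_mod_cast le_max_left m₁ m₂
  have e2 : 1 / ((m : ℝ) + 1) ≤ 1 / ((m₂ : ℝ) + 1) := by
    gcongr
    exact le_max_right m₁ m₂
  have hev : ∀ᶠ i in F, ∃ j ∈ Iic (b.N m), dist (D.x i p) (D.x i (m, j)) ≤ t + ε ∧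
      dist (D.x i (m, j)) (D.x i q) ≤ max (dist (D.x i p) (D.x i q) - t) 0 + ε := by
    filter_upwards [D.eventually_root_lt (p := p) (c := m + 1 - t) (by linarith)] with i hi
    obtain ⟨y, hy1, hy2⟩ := (S i).realTree.hasBetween (D.x i p) (D.x i q)
      -- The approximating pair may be closer together than `t`, hence the truncation.
      (min t (dist (D.x i p) (D.x i q))) ⟨le_min ht.1 dist_nonneg, min_le_right _ _⟩
    have hyt : dist (D.x i p) y ≤ t := hy1.le.trans (min_le_left _ _)
    have hyq : dist y (D.x i q) ≤ max (dist (D.x i p) (D.x i q) - t) 0 := by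
      rw [hy2]
      rcases min_choice t (dist (D.x i p) (D.x i q)) with h | h <;> rw [h]
      · exact le_max_left _ _
      · rw [sub_self]; exact le_max_right _ _
    obtain ⟨j, hj, hyj⟩ := D.x_net i m y (by linarith [dist_triangle_left y (S i).ρ (D.x i p)])
    refine ⟨j, hj, ?_, ?_⟩
    · linarith [dist_triangle (D.x i p) y (D.x i (m, j))]
    · linarith [dist_triangle_left (D.x i (m, j)) (D.x i q) y]
  obtain ⟨j, -, hjev⟩ := (Ultrafilter.eventually_exists_mem_iff (finite_Iic _)).1 hev
  have h1 := le_of_tendsto (D.tendsto_dist p (m, j)) (hjev.mono fun i h => h.1)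
  have h2 := le_of_tendsto_of_tendsto (D.tendsto_dist (m, j) q)
    ((((D.tendsto_dist p q).sub_const t).max tendsto_const_nhds).add_const ε)
    (hjev.mono fun i h => h.2)
  refine ⟨D.z (m, j), ?_, ?_⟩
  · linarith [dist_triangle a (D.z p) (D.z (m, j))]
  · have h3 : max (dist (D.z p) (D.z q) - t) 0 ≤ dist a c - t + 2 * ε := by
      refine max_le ?_ (by linarith [ht.2])
      linarith [dist_triangle4 (D.z p) a c (D.z q), dist_comm a (D.z p)]
    linarith [dist_triangle (D.z (m, j)) (D.z q) c, dist_comm c (D.z q)]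

theorem hasBetween : HasBetween D.X := by
  have := D.properSpace
  intro a c t ht
  obtain ⟨y, -, hy⟩ := (isCompact_closedBall a (t + 2)).exists_isMinOn
    ⟨a, mem_closedBall_self (by linarith [ht.1])⟩
    (f := fun y => max (dist a y - t) (dist y c - (dist a c - t))) (by fun_prop)
  have hle : max (dist a y - t) (dist y c - (dist a c - t)) ≤ 0 := by
    refine le_of_forall_pos_le_add fun ε hε => ?_
    have hε' : 0 < min ε 1 / 4 := by positivity
    have m1 : min ε 1 ≤ ε := min_le_left _ _
    have m2 : min ε 1 ≤ 1 := min_le_right _ _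
    obtain ⟨w, hw1, hw2⟩ := D.exists_almost_between a c ht hε'
    refine (hy (show w ∈ closedBall a (t + 2) by
      rw [mem_closedBall, dist_comm]; linarith)).trans (max_le ?_ ?_) <;> linarith
  obtain ⟨h1, h2⟩ := max_le_iff.1 hle
  exact ⟨y, by linarith [dist_triangle a y c], by linarith [dist_triangle a y c]⟩

theorem isRealTree : IsRealTree D.X := D.fourPoint.isRealTree D.hasBetween

theorem exists_limit_map [ProperSpace M] (hS : ∀ i, (S i).Obeys b) :
    ∃ Φ : D.X → M, Continuous Φ ∧
      ∀ p, Tendsto (fun i => (S i).φ (D.x i p)) F (𝓝 (Φ (D.z p))) := by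
  have hlim : ∀ p, ∃ c, Tendsto (fun i => (S i).φ (D.x i p)) F (𝓝 c) := by
    rintro ⟨m, j⟩
    have hδ := b.δ_pos m
    obtain ⟨n, hn⟩ := exists_nat_ge (((m : ℝ) + 1) / (b.δ m / 2))
    rw [div_le_iff₀ (by positivity)] at hn
    obtain ⟨c, -, hc⟩ := F.exists_tendsto_of_eventually_mem
      (isCompact_closedBall b.m₀ (n * (1 / ((m : ℝ) + 1)) + b.R₀))
      (f := fun i => (S i).φ (D.x i (m, j))) (Eventually.of_forall fun i => by
        have h1 := (hS i).dist_map_root_le m n _ (D.x_lt i m j) ((D.x_lt i m j).le.trans hn)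
        exact (dist_triangle _ _ _).trans (add_le_add h1 (hS i).root))
    exact ⟨c, hc⟩
  choose φ hφ using hlim
  obtain ⟨Φ, hΦ, hΦ'⟩ := exists_continuous_extension D.dense (φ := φ) (by
    intro x ε hε
    obtain ⟨m₁, hm₁⟩ := exists_nat_gt (dist x D.root)
    obtain ⟨m₂, hm₂⟩ := exists_nat_one_div_lt hε
    set m := max m₁ m₂
    have e1 : (m₁ : ℝ) ≤ m := by exact_mod_cast le_max_left m₁ m₂
    have e2 : 1 / ((m : ℝ) + 1) ≤ 1 / ((m₂ : ℝ) + 1) := by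
      gcongr
      exact le_max_right m₁ m₂
    have hδ := b.δ_pos m
    refine ⟨min (b.δ m / 2) 1, by positivity, fun p q hp hq => ?_⟩
    rw [lt_min_iff] at hp hq
    have h1 := D.eventually_root_lt (p := p) (c := m + 1)
      (by linarith [dist_triangle (D.z p) x D.root])
    have h2 := D.eventually_root_lt (p := q) (c := m + 1)
      (by linarith [dist_triangle (D.z q) x D.root])
    have h3 := (D.tendsto_dist p q).eventually (gt_mem_nhds
      (show dist (D.z p) (D.z q) < b.δ m by linarith [dist_triangle_right (D.z p) (D.z q) x]))
    refine (le_of_tendsto ((hφ p).dist (hφ q)) ?_).trans (e2.trans hm₂.le)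
    filter_upwards [h1, h2, h3] with i h1 h2 h3
    exact (hS i).equi m _ _ h1 h2 h3)
  exact ⟨Φ, hΦ, fun p => by rw [hΦ']; exact hφ p⟩

end LimitSpace

end SpatialTree

/-! ### The limit tree and the compactness criterion -/

theorem exists_glue {X Y P : Type u} [MetricSpace X] [MetricSpace Y] [Nonempty P] (a : P → X)
    (c : P → Y) {e : ℝ} (he : 0 < e) (h : ∀ p q, |dist (a p) (a q) - dist (c p) (c q)| ≤ 2 * e) :
    ∃ (Z : Type u) (_ : MetricSpace Z) (ψ : X → Z) (ψ' : Y → Z), Isometry ψ ∧ Isometry ψ' ∧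
      ∀ p, dist (ψ (a p)) (ψ' (c p)) = e := by
  let _ : MetricSpace (X ⊕ Y) := glueMetricApprox a c e he h
  exact ⟨X ⊕ Y, inferInstance, Sum.inl, Sum.inr, Isometry.of_dist_eq fun _ _ => rfl,
    Isometry.of_dist_eq fun _ _ => rfl, fun p => glueDist_glued_points a c e p⟩

namespace SpatialTree

open RootedSpace Filter Topology CompactlySupported

variable {M : Type v} [MetricSpace M]

namespace LimitSpace

variable {I : Type*} {F : Ultrafilter I} {S : I → SpatialTree.{u, v} M} {b : TreeBounds M}
  (D : LimitSpace F S b)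

theorem exists_measurable_index (k : ℕ × I) :
    ∃ κ : (S k.2).X → ℕ, Measurable κ ∧ ∀ y, dist y (S k.2).ρ < k.1 + 1 →
      κ y ≤ b.N k.1 ∧ dist y (D.x k.2 (k.1, κ y)) ≤ 1 / ((k.1 : ℝ) + 1) := by
  classical
  obtain ⟨m, i⟩ := k
  -- The second alternative makes `p` satisfiable outside the ball too. The first index satisfying
  -- `p` depends measurably on `y` because both alternatives are closed conditions.
  let p : (S i).X → ℕ → Prop := fun y j =>
    dist y (D.x i (m, j)) ≤ 1 / ((m : ℝ) + 1) ∨ (m : ℝ) + 1 ≤ dist y (S i).ρ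
  have hp : ∀ y, ∃ j, p y j := by
    intro y
    rcases lt_or_ge (dist y (S i).ρ) (m + 1) with h | h
    · obtain ⟨j, -, hj⟩ := D.x_net i m y h
      exact ⟨j, Or.inl hj⟩
    · exact ⟨0, Or.inr h⟩
  refine ⟨fun y => Nat.find (hp y), measurable_find hp fun j => ?_, fun y hy => ⟨?_, ?_⟩⟩
  · have h1 : IsClosed {y | dist y (D.x i (m, j)) ≤ 1 / ((m : ℝ) + 1)} := isClosed_closedBall
    have h2 : IsClosed {y | (m : ℝ) + 1 ≤ dist y (S i).ρ} :=
      isClosed_le continuous_const (by fun_prop)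
    exact (h1.union h2).measurableSet
  · obtain ⟨j, hj, hyj⟩ := D.x_net i m y hy
    exact (Nat.find_min' (hp y) (Or.inl hyj)).trans hj
  · exact (Nat.find_spec (hp y)).resolve_right hy.not_ge

/-- The nets at scale `m` in `S i` and in the limit space are close. -/
def Good (Φ : D.X → M) (k : ℕ × I) : Prop :=
  (∀ j ≤ b.N k.1, ∀ j' ≤ b.N k.1, |dist (D.z (k.1, j)) (D.z (k.1, j')) -
    dist (D.x k.2 (k.1, j)) (D.x k.2 (k.1, j'))| ≤ 1 / ((k.1 : ℝ) + 1)) ∧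
  ∀ j ≤ b.N k.1, dist (Φ (D.z (k.1, j))) ((S k.2).φ (D.x k.2 (k.1, j))) ≤ 1 / ((k.1 : ℝ) + 1)

theorem eventually_good {Φ : D.X → M}
    (hΦ : ∀ p, Tendsto (fun i => (S i).φ (D.x i p)) F (𝓝 (Φ (D.z p)))) (m : ℕ) :
    ∀ᶠ i in F, D.Good Φ (m, i) := by
  have hm : 0 < 1 / ((m : ℝ) + 1) := by positivity
  refine Eventually.and ?_ ?_
  · refine (eventually_all_finite (finite_Iic (b.N m))).2 fun j _ =>
      (eventually_all_finite (finite_Iic (b.N m))).2 fun j' _ => ?_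
    have := (tendsto_const_nhds.sub (D.tendsto_dist (m, j) (m, j'))).abs
      (a := dist (D.z (m, j)) (D.z (m, j')) - dist (D.z (m, j)) (D.z (m, j')))
    rw [sub_self, abs_zero] at this
    exact (this.eventually (gt_mem_nhds hm)).mono fun i h => h.le
  · refine (eventually_all_finite (finite_Iic (b.N m))).2 fun j _ => ?_
    have := (tendsto_const_nhds (x := Φ (D.z (m, j)))).dist (hΦ (m, j))
    rw [dist_self] at this
    exact (this.eventually (gt_mem_nhds hm)).mono fun i h => h.le

variable {D} in
theorem Good.dist_root_le {Φ : D.X → M} {k : ℕ × I} (h : D.Good Φ k) {j : ℕ} (hj : j ≤ b.N k.1) :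
    |dist (D.z (k.1, j)) D.root - dist (D.x k.2 (k.1, j)) (S k.2).ρ| ≤ 1 / ((k.1 : ℝ) + 1) := by
  have := h.1 j hj 0 (Nat.zero_le _)
  rwa [D.z_root, D.x_root] at this

/-- An index of a point of the net at scale `k.1` which is close to `y`. -/
def index (k : ℕ × I) : (S k.2).X → ℕ := (D.exists_measurable_index k).choose

theorem measurable_index (k : ℕ × I) : Measurable (D.index k) :=
  (D.exists_measurable_index k).choose_spec.1

theorem index_le {k : ℕ × I} {y : (S k.2).X} (hy : dist y (S k.2).ρ < k.1 + 1) :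
    D.index k y ≤ b.N k.1 :=
  ((D.exists_measurable_index k).choose_spec.2 y hy).1

theorem dist_index_le {k : ℕ × I} {y : (S k.2).X} (hy : dist y (S k.2).ρ < k.1 + 1) :
    dist y (D.x k.2 (k.1, D.index k y)) ≤ 1 / ((k.1 : ℝ) + 1) :=
  ((D.exists_measurable_index k).choose_spec.2 y hy).2

/-- The map from `S k.2` to the limit space that takes a point to a point of the net. -/
def toLimit (k : ℕ × I) (y : (S k.2).X) : D.X := D.z (k.1, D.index k y)

theorem measurable_toLimit [MeasurableSpace D.X] (k : ℕ × I) : Measurable (D.toLimit k) :=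
  (measurable_from_nat (f := fun j => D.z (k.1, j))).comp (D.measurable_index k)

/-- The measure of a ball of `S k.2`, transported to the limit space. -/
def approxMeasure [MeasurableSpace D.X] (k : ℕ × I) : Measure D.X :=
  ((S k.2).μ.restrict (ball (S k.2).ρ (k.1 + 1))).map (D.toLimit k)

theorem isFiniteMeasure_approxMeasure [MeasurableSpace D.X] (hS : ∀ i, (S i).Obeys b)
    (k : ℕ × I) : IsFiniteMeasure (D.approxMeasure k) := by
  have : IsFiniteMeasure ((S k.2).μ.restrict (ball (S k.2).ρ (k.1 + 1))) :=
    ⟨by rw [Measure.restrict_apply_univ]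
        exact ((hS k.2).mass k.1).trans_lt ENNReal.coe_lt_top⟩
  exact Measure.isFiniteMeasure_map _ _

theorem approxMeasure_apply [MeasurableSpace D.X] (k : ℕ × I) {A : Set D.X}
    (hA : MeasurableSet A) : D.approxMeasure k A =
      (S k.2).μ {y | D.toLimit k y ∈ A ∧ dist y (S k.2).ρ < k.1 + 1} := by
  rw [approxMeasure, Measure.map_apply (D.measurable_toLimit k) hA,
    Measure.restrict_apply (D.measurable_toLimit k hA)]
  rfl

theorem le_approxMeasure_image [MeasurableSpace D.X] (k : ℕ × I) {B : Set (S k.2).X}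
    (hB : B ⊆ ball (S k.2).ρ (k.1 + 1)) :
    (S k.2).μ B ≤ D.approxMeasure k (D.toLimit k '' B) := by
  refine le_trans ?_ (Measure.le_map_apply (D.measurable_toLimit k).aemeasurable _)
  rw [← Measure.restrict_eq_self _ hB]
  exact measure_mono (subset_preimage_image _ _)

theorem approxMeasure_closedBall_le [MeasurableSpace D.X] [BorelSpace D.X]
    (hS : ∀ i, (S i).Obeys b) {Φ : D.X → M} {k : ℕ × I} (hk : D.Good Φ k) (R : ℝ) :
    D.approxMeasure k (closedBall D.root R) ≤ b.C ⌈R + 2⌉₊ := by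
  rw [D.approxMeasure_apply k measurableSet_closedBall]
  refine le_trans (measure_mono ?_) ((hS k.2).mass ⌈R + 2⌉₊)
  rintro y ⟨hy, hyk⟩
  have h1 := D.dist_index_le hyk
  have h2 := abs_le.1 (hk.dist_root_le (D.index_le hyk))
  have h3 : 1 / ((k.1 : ℝ) + 1) ≤ 1 := by
    rw [div_le_one (by positivity)]
    linarith [Nat.cast_nonneg (α := ℝ) k.1]
  have h4 := Nat.le_ceil (R + 2)
  rw [mem_closedBall] at hy
  unfold toLimit at hy
  rw [mem_ball]
  linarith [dist_triangle y (D.x k.2 (k.1, D.index k y)) (S k.2).ρ]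

/-- The limit tree. -/
def tree [MeasurableSpace D.X] [BorelSpace D.X] (Φ : D.X → M) (hΦ : Continuous Φ)
    (μ : Measure D.X) (hμ : IsLocallyFiniteMeasure μ) : SpatialTree.{u, v} M where
  X := D.X
  μ := μ
  φ := Φ
  ρ := D.root
  realTree := D.isRealTree
  complete := D.complete
  locallyCompact := have := D.properSpace; inferInstance
  locallyFinite := hμ
  continuous_φ := hΦ

variable {D} in
/-- The tree `S k.2` is close to the limit tree if the nets and the measures are close. -/
theorem Good.close [MeasurableSpace D.X] [BorelSpace D.X] {Φ : D.X → M} {hΦ : Continuous Φ}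
    {μ : Measure D.X} {hμ : IsLocallyFiniteMeasure μ} {k : ℕ × I} (hk : D.Good Φ k)
    {η θ δ R : ℝ} (hθ : 0 < θ) (hθη : θ ≤ η) (hRk : R ≤ k.1)
    (hθk : 1 / ((k.1 : ℝ) + 1) ≤ θ / 8)
    (hθ1 : θ ≤ 1) (hθδ : 4 * θ < δ)
    (hS : ∀ x y, dist x (S k.2).ρ < R + 5 → dist y (S k.2).ρ < R + 5 → dist x y < δ →
      dist ((S k.2).φ x) ((S k.2).φ y) ≤ η / 3)
    (hΦδ : ∀ x ∈ closedBall D.root (R + 1), ∀ y ∈ closedBall D.root (R + 1), dist x y < δ →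
      dist (Φ x) (Φ y) < η / 3)
    (hmeas : ∀ A ⊆ closedBall D.root (R + 1),
      D.approxMeasure k A ≤ μ (thickening (θ / 2) A) + ENNReal.ofReal (θ / 2) ∧
      μ A ≤ D.approxMeasure k (thickening (θ / 2) A) + ENNReal.ofReal (θ / 2)) :
    Close (D.tree Φ hΦ μ hμ) (S k.2) η R := by
  set e := 1 / ((k.1 : ℝ) + 1) with he
  have he0 : 0 < e := by positivity
  -- The limit space and `S k.2` are glued along their nets at scale `k.1`, with corresponding
  -- points at distance `e`; `Good` bounds the distortion.
  let P : Type u := ULift {j : ℕ // j ≤ b.N k.1}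
  have : Nonempty P := ⟨⟨0, Nat.zero_le _⟩⟩
  obtain ⟨Z, _, ψ, ψ', hψ, hψ', hd⟩ := exists_glue (P := P) (fun j => D.z (k.1, j.down.1))
    (fun j => D.x k.2 (k.1, j.down.1)) he0 fun p q =>
      (hk.1 _ p.down.2 _ q.down.2).trans (by linarith)
  have hd : ∀ j ≤ b.N k.1, dist (ψ (D.z (k.1, j))) (ψ' (D.x k.2 (k.1, j))) = e :=
    fun j hj => hd ⟨j, hj⟩
  have hto : ∀ x y, dist y (S k.2).ρ < k.1 + 1 →
      dist (ψ x) (ψ' y) ≤ dist x (D.toLimit k y) + 2 * e := by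
    intro x y hy
    have h1 := hd _ (D.index_le hy)
    have h2 := D.dist_index_le hy
    rw [← hψ'.dist_eq] at h2
    have h3 := dist_triangle4 (ψ x) (ψ (D.toLimit k y)) (ψ' (D.x k.2 (k.1, D.index k y))) (ψ' y)
    rw [hψ.dist_eq] at h3
    unfold toLimit at h3 ⊢
    linarith [dist_comm (ψ' y) (ψ' (D.x k.2 (k.1, D.index k y)))]
  refine ⟨θ, Z, inferInstance, ψ, ψ', hθ, hθη, hψ, hψ', ?_, ?_, ?_, ?_, ?_, ?_⟩
  · show dist (ψ D.root) (ψ' (S k.2).ρ) ≤ θ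
    have := hd 0 (Nat.zero_le _)
    rw [D.z_root, D.x_root] at this
    linarith
  · intro (x : D.X) (hx : dist x D.root ≤ R)
    obtain ⟨j, hj, hxj⟩ := D.net k.1 x (by linarith)
    refine ⟨D.x k.2 (k.1, j), ?_⟩
    rw [← hψ.dist_eq] at hxj
    linarith [dist_triangle (ψ x) (ψ (D.z (k.1, j))) (ψ' (D.x k.2 (k.1, j))), hd j hj]
  · intro y (hy : dist y (S k.2).ρ ≤ R)
    refine ⟨D.toLimit k y, (hto _ y (by linarith)).trans ?_⟩
    rw [dist_self]
    linarith
  · intro (x : D.X) (hx : dist x D.root ≤ R) y (hy : dist y (S k.2).ρ ≤ R) hxy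
    obtain ⟨j, hj, hxj⟩ := D.net k.1 x (by linarith)
    have h1 : dist (Φ x) (Φ (D.z (k.1, j))) < η / 3 := by
      refine hΦδ x (by rw [mem_closedBall]; linarith) _ ?_ (by linarith)
      rw [mem_closedBall]
      linarith [dist_triangle_left (D.z (k.1, j)) D.root x]
    have h2 := hk.2 j hj
    -- The distances add up to `e + 2 * e + 3 * θ`, and `e ≤ θ / 8`.
    have h3 : dist (D.x k.2 (k.1, j)) y ≤ 4 * θ := by
      rw [← hψ'.dist_eq]
      rw [← hψ.dist_eq] at hxj
      have := hd j hj
      linarith [dist_triangle4 (ψ' (D.x k.2 (k.1, j))) (ψ (D.z (k.1, j))) (ψ x) (ψ' y),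
        dist_comm (ψ x) (ψ (D.z (k.1, j))),
        dist_comm (ψ (D.z (k.1, j))) (ψ' (D.x k.2 (k.1, j)))]
    have h4 := hS (D.x k.2 (k.1, j)) y (by linarith [dist_triangle (D.x k.2 (k.1, j)) y (S k.2).ρ])
      (by linarith) (by linarith)
    show dist (Φ x) ((S k.2).φ y) ≤ η
    linarith [dist_triangle4 (Φ x) (Φ (D.z (k.1, j))) ((S k.2).φ (D.x k.2 (k.1, j)))
      ((S k.2).φ y)]
  · intro (A : Set D.X) (hA : A ⊆ closedBall D.root R)
    refine ((hmeas A (hA.trans (closedBall_subset_closedBall (by linarith)))).2).trans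
      (add_le_add ?_ (ENNReal.ofReal_le_ofReal (by linarith)))
    rw [D.approxMeasure_apply k isOpen_thickening.measurableSet]
    refine measure_mono ?_
    rintro y ⟨hy, hyk⟩
    obtain ⟨x, hx, hxy⟩ := mem_thickening_iff.1 hy
    rw [dist_comm] at hxy
    exact ⟨x, hx, (hto x y hyk).trans_lt (by linarith)⟩
  · intro B hB
    have hBk : ∀ y ∈ B, dist y (S k.2).ρ < k.1 + 1 := fun y hy => by
      have := mem_closedBall.1 (hB hy)
      linarith
    refine (D.le_approxMeasure_image k hBk).trans ?_
    refine ((hmeas _ ?_).1).trans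
      (add_le_add (measure_mono ?_) (ENNReal.ofReal_le_ofReal (by linarith)))
    · rintro _ ⟨y, hy, rfl⟩
      have h1 := D.dist_index_le (hBk y hy)
      have h2 := abs_le.1 (hk.dist_root_le (D.index_le (hBk y hy)))
      have h3 := mem_closedBall.1 (hB hy)
      rw [mem_closedBall]
      unfold toLimit
      linarith [dist_triangle_left (D.x k.2 (k.1, D.index k y)) (S k.2).ρ y]
    · intro x hx
      obtain ⟨_, ⟨y, hy, rfl⟩, hxy⟩ := mem_thickening_iff.1 hx
      exact ⟨y, hy, (hto x y (hBk y hy)).trans_lt (by linarith)⟩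

end LimitSpace

theorem exists_tendsto_delta [ProperSpace M] {I : Type*} (F : Ultrafilter I)
    (S : I → SpatialTree.{u, v} M) {b : TreeBounds M} (hS : ∀ i, (S i).Obeys b) :
    ∃ T : SpatialTree.{u, v} M, Tendsto (fun i => delta T (S i)) F (𝓝 0) := by
  obtain ⟨D⟩ := nonempty_limitSpace F S b hS
  obtain ⟨Φ, hΦ, hΦlim⟩ := D.exists_limit_map hS
  have := D.properSpace
  let _ : MeasurableSpace D.X := _root_.borel D.X
  have : BorelSpace D.X := ⟨rfl⟩
  have := D.isFiniteMeasure_approxMeasure hS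
  -- The transported measures depend on the scale `m` as well as on `i`. The curried filter sends
  -- `m` to infinity while allowing the `F`-large set of `i` to depend on `m`.
  have hne : (Filter.curry (atTop : Filter ℕ) (F : Filter I)).NeBot := by
    refine ⟨fun h => ?_⟩
    have h' : ∀ᶠ _ in Filter.curry (atTop : Filter ℕ) (F : Filter I), False := by simp [h]
    obtain ⟨_, hm⟩ := (eventually_curry_iff.1 h').exists
    exact hm.exists.elim fun _ h => h
  let G : Ultrafilter (ℕ × I) := Ultrafilter.of (Filter.curry atTop (F : Filter I))
  have hG : ∀ {p : ℕ × I → Prop}, (∀ᶠ m in atTop, ∀ᶠ i in F, p (m, i)) → ∀ᶠ k in G, p k :=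
    fun h => Ultrafilter.of_le _ (eventually_curry_iff.2 h)
  have hgood : ∀ᶠ k in G, D.Good Φ k := hG (Eventually.of_forall (D.eventually_good hΦlim))
  obtain ⟨μ, hμ, hlim⟩ := exists_vague_limit G D.approxMeasure D.root fun R =>
    ⟨_, hgood.mono fun k hk => D.approxMeasure_closedBall_le hS hk R⟩
  refine ⟨D.tree Φ hΦ μ hμ, ?_⟩
  have : ProperSpace (D.tree Φ hΦ μ hμ).X := D.properSpace
  refine tendsto_delta_of_close _ _ fun n => ?_
  -- Closeness does not involve the scale. If it failed on an `F`-large set, as the ultrafilter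
  -- dichotomy would give, it would fail `G`-eventually.
  suffices h : ∀ᶠ k : ℕ × I in G, Close (D.tree Φ hΦ μ hμ) (S k.2) (1 / ((n : ℝ) + 1)) n by
    by_contra hcon
    have h' : ∀ᶠ k : ℕ × I in G,
        ¬ Close (D.tree Φ hΦ μ hμ) (S k.2) (1 / ((n : ℝ) + 1)) n :=
      hG (Eventually.of_forall fun _ => Ultrafilter.eventually_not.2 hcon)
    obtain ⟨k, h1, h2⟩ := (h.and h').exists
    exact h2 h1
  set η := 1 / ((n : ℝ) + 1) with hη
  have hη0 : 0 < η := by positivity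
  have hη1 : η ≤ 1 := by
    rw [hη, div_le_one (by positivity)]
    linarith [Nat.cast_nonneg (α := ℝ) n]
  obtain ⟨δ', hδ', hunif⟩ := Metric.uniformContinuousOn_iff.1
    ((isCompact_closedBall D.root ((n : ℝ) + 1)).uniformContinuousOn_of_continuous
      hΦ.continuousOn) (η / 3) (by positivity)
  -- At this scale `1 / (m₁ + 1) ≤ η / 3` and `m₁ + 1 ≥ n + 5`, as `Good.close` requires.
  set m₁ := 3 * n + 4 with hm₁
  have hδ₁ := b.δ_pos m₁
  set δ := min δ' (b.δ m₁) with hδ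
  have hδ0 : 0 < δ := lt_min hδ' hδ₁
  set θ := min η (δ / 5) with hθ
  have hθ0 : 0 < θ := by positivity
  have hθη : θ ≤ η := min_le_left _ _
  have hθδ : θ ≤ δ / 5 := min_le_right _ _
  obtain ⟨m₂, hm₂⟩ := exists_nat_one_div_lt (show 0 < θ / 8 by positivity)
  have hlarge : ∀ᶠ k : ℕ × I in G, max n m₂ ≤ k.1 :=
    hG ((eventually_ge_atTop _).mono fun m hm => Eventually.of_forall fun _ => hm)
  filter_upwards [hgood, hlarge, eventually_measure_le_measure_thickening hlim D.root (n + 1)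
    (half_pos hθ0)] with k hk hkn hkm
  have hk1 : n ≤ k.1 := (le_max_left _ _).trans hkn
  have hk2 : m₂ ≤ k.1 := (le_max_right _ _).trans hkn
  refine hk.close (δ := δ) hθ0 hθη (by exact_mod_cast hk1) ?_
    (hθη.trans hη1) (by linarith) ?_ ?_ hkm
  · refine le_trans ?_ hm₂.le
    gcongr
  · intro x y hx hy hxy
    have hle : (n : ℝ) + 5 ≤ (m₁ : ℝ) + 1 := by
      rw [hm₁]
      push_cast
      linarith [Nat.cast_nonneg (α := ℝ) n]
    refine ((hS k.2).equi m₁ x y (by linarith) (by linarith)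
      (hxy.trans_le (min_le_right _ _))).trans ?_
    rw [hη, div_div]
    refine one_div_le_one_div_of_le (by positivity) ?_
    rw [hm₁]
    push_cast
    linarith
  · intro x hx y hy hxy
    exact hunif x hx y hy (hxy.trans_le (min_le_left _ _))

theorem isCompact_obeys [ProperSpace M] (b : TreeBounds M) :
    IsCompact {T : SpatialTree.{u, v} M | T.Obeys b} := by
  rw [isCompact_iff_ultrafilter_le_nhds]
  intro F hF
  have hmem : {T : SpatialTree.{u, v} M | T.Obeys b} ∈ F := le_principal_iff.1 hF
  let F' : Ultrafilter {T : SpatialTree.{u, v} M | T.Obeys b} :=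
    F.comap Subtype.val_injective (by simpa using hmem)
  obtain ⟨T, hT⟩ := exists_tendsto_delta F' (fun T => T.1) fun T => T.2
  have hle : (F : Filter (SpatialTree.{u, v} M)) ≤ 𝓝 T := by
    intro s hs
    obtain ⟨U, hUs, hU, hTU⟩ := mem_nhds_iff.1 hs
    obtain ⟨ε, hε, hball⟩ := hU T hTU
    have h1 : ∀ᶠ T' : {T : SpatialTree.{u, v} M | T.Obeys b} in F', T'.1 ∈ s :=
      (hT.eventually (gt_mem_nhds hε)).mono fun T' h => hUs (hball T'.1 h)
    have h2 : Subtype.val ⁻¹' s ∈ Filter.comap Subtype.val (F : Filter (SpatialTree.{u, v} M)) := h1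
    obtain ⟨t, ht, hts⟩ := mem_comap.1 h2
    filter_upwards [ht, hmem] with T' h h'
    exact hts (show (⟨T', h'⟩ : {T : SpatialTree.{u, v} M | T.Obeys b}) ∈ Subtype.val ⁻¹' t from h)
  exact ⟨T, (isClosed_obeys b).mem_of_tendsto (f := id) hle hmem, hle⟩

end SpatialTree

theorem lemma3p5 {M : Type v} [MetricSpace M] [ProperSpace M]
    (A : Set (SpatialTree.{u, v} M))
    (cover : ∀ r : ℝ, 0 < r → ∀ ε : ℝ≥0, 0 < ε → ∃ N : ℕ, ∀ T ∈ A,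
      ∃ s : Finset T.X, s.card < N ∧ IsCover ε (T.rootBall r) (s : Set T.X))
    (mass : ∀ r : ℝ, 0 < r → (⨆ T ∈ A, T.μ (T.rootBall r)) < ∞)
    (root : Bornology.IsBounded {m : M | ∃ T ∈ A, m = T.φ T.ρ})
    (equi : ∀ r : ℝ, 0 < r → ∀ ε : ℝ≥0, 0 < ε → ∃ δ : ℝ, 0 < δ ∧
      (⨆ T ∈ A, ⨆ (x ∈ T.rootBall r) (y ∈ T.rootBall r) (_ : dist x y ≤ δ),
        edist (T.φ x) (T.φ y)) < ε) :
    IsCompact (closure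
      ((fun T => (⟦T⟧ : SpatialTreeSpace.{u, v} M)) '' A)) := by
  -- The base point of the bounds is the image of the root of a tree in `A`.
  rcases A.eq_empty_or_nonempty with rfl | hA
  · simp
  obtain ⟨b, hb⟩ := SpatialTree.exists_bounds A hA cover mass root equi
  set K : Set (SpatialTree.{u, v} M) := {T | T.Obeys b}
  have hcont : Continuous fun T : SpatialTree.{u, v} M => (⟦T⟧ : SpatialTreeSpace.{u, v} M) :=
    continuous_quotient_mk'
  have hK : IsCompact ((fun T => (⟦T⟧ : SpatialTreeSpace.{u, v} M)) '' K) :=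
    (SpatialTree.isCompact_obeys b).image hcont
  -- Saturation makes the image of the closed set `K` closed in the quotient.
  have hsat : (fun T => (⟦T⟧ : SpatialTreeSpace.{u, v} M)) ⁻¹'
      ((fun T => (⟦T⟧ : SpatialTreeSpace.{u, v} M)) '' K) = K := by
    refine Subset.antisymm ?_ (subset_preimage_image _ _)
    rintro T ⟨T', hT', h⟩
    exact SpatialTree.Obeys.of_equivalent hT' (Setoid.symm (Quotient.exact h))
  have hclosed : IsClosed ((fun T => (⟦T⟧ : SpatialTreeSpace.{u, v} M)) '' K) := by
    refine (isQuotientMap_quotient_mk'.isClosed_preimage).1 ?_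
    refine (congrArg IsClosed hsat).mpr ?_
    exact SpatialTree.isClosed_obeys b
  exact hK.of_isClosed_subset isClosed_closure
    (closure_minimal (image_mono fun T hT => hb T hT) hclosed)

end
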